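/- **Definitions.** Let $X$ be a finite set. A *root datum* is a quadruple $v=(\mathfrak h,a,b,p)$, where $\mathfrak h$ is a finite-dimensional complex vector space, $a:X\to\mathfrak h$ and $b:X\to\mathfrak h^*$ are families of linearly independent vectors, and $p:X\to\mathbb Z/2$. Put $a_{xy}=\langle a(x),b(y)\rangle$. An element $x\in X$ is *reflectable* at $v$ if (i) $a_{xx}=0$ implies $p(x)=1$; (ii) if $a_{xx}\ne0$ and $p(x)=0$, then $2a_{xy}/a_{xx}\in\mathbb Z_{\le0}$ for all $y\ne x$; (iii) if $a_{xx}\neq0$ and $p(x)=1$, then $a_{xy}/a_{xx}\in\mathbb Z_{\le0}$ for all $y\ne x$. In this case there is a *reflexion* $r_x:v\to v'=(\mathfrak h,a',b',p')$, defined as follows. * If $a_{xx}\ne0$ (*anisotropic* reflexion): $a'(y)=a(y)-2\frac{a_{yx}}{a_{xx}}a(x)$, $b'(y)=b(y)-2\frac{a_{xy}}{a_{xx}}b(x)$, $p'(y)=p(y)$ for all $y\in X$. * If $a_{xx}=0$ (*isotropic* reflexion): $(a'(x),b'(x),p'(x))=(-a(x),-b(x),p(x))$; for $y\ne x$ with $a_{xy}=0$,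 $(a'(y),b'(y),p'(y))=(a(y),b(y),p(y))$; for $y\neq x$ with $a_{xy}\ne0$, $(a'(y),b'(y),p'(y))=\bigl(a(y)+\frac{a_{yx}}{a_{xy}}a(x),\,b(y)+b(x),\,p(y)+1\bigr)$. The *root groupoid* has the root data as objects; its arrows are the compositions of reflexions (inducing $\mathrm{id}_{\mathfrak h}$), of tautological arrows (given by isomorphisms $\theta:\mathfrak h\to\mathfrak h'$, with $a'=\theta\circ a$, $b'=b\circ\theta^{-1}$, $p'=p$) and of homotheties ($a'(x)=\lambda(x)a(x)$ with $\lambda:X\to\mathbb C^\times$, everything else unchanged, inducing $\mathrm{id}_{\mathfrak h}$). Two compositions $v\to v'$ are identified if they induce the same isomorphism $\mathfrak h\to\mathfrak h'$. For a root datum $v$ let $\tilde{\mathfrak g}(v)$ be the Lie superalgebra generated by $\mathfrak h$ (even) and elements $e_x,f_x$ of parity $p(x)$, $x\in X$, with relations $[\mathfrak h,\mathfrak h]=0$, $[t,e_x]=\langle t,b(x)\rangle e_x$, $[t,f_x]=-\langle t,b(x)\rangle f_x$ for $t\in\mathfrak h$, $[e_x,f_x]=a(x)$, and $[e_x,f_y]=0$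 for $x\neq y$. A root datum $v$ is *admissible* if one can choose, for all $w$ in the connected component of $v$ in the root groupoid, quotients $\mathfrak g(w)$ of $\tilde{\mathfrak g}(w)$ by ideals meeting $\mathfrak h$ trivially, so that for every arrow $w\to w'$ in the component the induced isomorphism $\mathfrak h(w)\to\mathfrak h(w')$ extends to an isomorphism $\mathfrak g(w)\to\mathfrak g(w')$ of Lie superalgebras. The *skeleton* $\mathrm{Sk}(v)$ is the graph whose vertices are the root data obtained from $v$ by finite sequences of reflexions, and whose edges are the reflexions. **Proposition (Exchange condition).** Let $v$ be an admissible root datum, and let $$v_0\xrightarrow{r_{x_1}}v_1\to\cdots\xrightarrow{r_{x_n}}v_n$$ be a sequence of reflexions in $\mathrm{Sk}(v)$ that is a shortest path from $v_0$ to $v_n$. Let $r_y:v_0'\to v_0$ be an anisotropic reflexion such that the path $v_0'\to v_0\to\cdots\to v_n$ is not shortest. Then there exists $j\in\{1,\dots,n\}$ such that the namesake path $$v'_0\xrightarrow{r_{x_1}}v'_1\to\cdots\xrightarrow{r_{x_{j-1}}}v'_{j-1}$$ is defined (each $x_i$, $1\le i\le j-1$, is reflectable at $v'_{i-1}$), $v'_{j-1}=v_j$,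 and the composition $v'_0\xrightarrow{r_y}v_0\xrightarrow{r_{x_1}}\cdots\xrightarrow{r_{x_j}}v_j$ coincides with the composition $v'_0\xrightarrow{r_{x_1}}\cdots\xrightarrow{r_{x_{j-1}}}v'_{j-1}=v_j$. -/

import Mathlib

universe u v

/-- A root datum `(h, a : X → h, b : X → h*, p : X → ℤ/2)` over `ℂ`. -/
@[ext]
structure SuperRootDatum (X : Type v) (h : Type u) [AddCommGroup h] [Module ℂ h] where
  a : X → h
  b : X → Module.Dual ℂ h
  p : X → ZMod 2
  linInd_a : LinearIndependent ℂ a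
  linInd_b : LinearIndependent ℂ b

/-- A (complex) Lie superalgebra. -/
structure LieSuperalgebra where
  carrier : Type u
  [addCommGroup : AddCommGroup carrier]
  [module : Module ℂ carrier]
  /-- the homogeneous components -/
  grade : ZMod 2 → Submodule ℂ carrier
  isInternal : DirectSum.IsInternal grade
  bracket : carrier →ₗ[ℂ] carrier →ₗ[ℂ] carrier
  bracket_mem : ∀ (i j : ZMod 2) (s t : carrier), s ∈ grade i → t ∈ grade j →
    bracket s t ∈ grade (i + j)
  bracket_skew : ∀ (i j : ZMod 2) (s t : carrier), s ∈ grade i → t ∈ grade j →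
    bracket s t = -((-1 : ℂ) ^ (i.val * j.val) • bracket t s)
  jacobi : ∀ (i j : ZMod 2) (s t r : carrier), s ∈ grade i → t ∈ grade j →
    bracket s (bracket t r) =
      bracket (bracket s t) r + (-1 : ℂ) ^ (i.val * j.val) • bracket t (bracket s r)

attribute [instance] LieSuperalgebra.addCommGroup LieSuperalgebra.module

/-- Isomorphisms of Lie superalgebras. -/
structure LieSuperalgebra.Iso (g g' : LieSuperalgebra.{u}) where
  toEquiv : g.carrier ≃ₗ[ℂ] g'.carrier
  map_grade : ∀ (i : ZMod 2) (s : g.carrier), s ∈ g.grade i → toEquiv s ∈ g'.grade i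
  map_bracket : ∀ s t : g.carrier, toEquiv (g.bracket s t) = g'.bracket (toEquiv s) (toEquiv t)

namespace SuperRootDatum

variable {X : Type v} {h : Type u} [AddCommGroup h] [Module ℂ h]

/-- The entry `a_{xy} = ⟨a(x), b(y)⟩` of the Cartan matrix. -/
def cartan (v : SuperRootDatum X h) (x y : X) : ℂ := v.b y (v.a x)

/-- `x` is anisotropic at `v`; it is isotropic otherwise. -/
def Anisotropic (v : SuperRootDatum X h) (x : X) : Prop := v.cartan x x ≠ 0

/-- `x` is reflectable at `v`. -/
def Reflectable (v : SuperRootDatum X h) (x : X) : Prop :=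
  (v.cartan x x = 0 → v.p x = 1) ∧
  (v.cartan x x ≠ 0 → v.p x = 0 →
    ∀ y, y ≠ x → ∃ n : ℕ, 2 * v.cartan x y / v.cartan x x = -(n : ℂ)) ∧
  (v.cartan x x ≠ 0 → v.p x = 1 →
    ∀ y, y ≠ x → ∃ n : ℕ, v.cartan x y / v.cartan x x = -(n : ℂ))

section Reflexion

variable [DecidableEq X]

open Classical in
/-- The new vectors `a'(y)` after the reflexion `r_x`. -/
noncomputable def reflA (v : SuperRootDatum X h) (x y : X) : h :=
  if v.cartan x x ≠ 0 then v.a y - (2 * v.cartan y x / v.cartan x x) • v.a x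
  else if y = x then -v.a x
  else if v.cartan x y = 0 then v.a y
  else v.a y + (v.cartan y x / v.cartan x y) • v.a x

open Classical in
/-- The new covectors `b'(y)` after the reflexion `r_x`. -/
noncomputable def reflB (v : SuperRootDatum X h) (x y : X) : Module.Dual ℂ h :=
  if v.cartan x x ≠ 0 then v.b y - (2 * v.cartan x y / v.cartan x x) • v.b x
  else if y = x then -v.b x
  else if v.cartan x y = 0 then v.b y
  else v.b y + v.b x

open Classical in
/-- The new parities `p'(y)` after the reflexion `r_x`. -/
noncomputable def reflP (v : SuperRootDatum X h) (x y : X) : ZMod 2 :=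
  if v.cartan x x ≠ 0 then v.p y
  else if y = x then v.p x
  else if v.cartan x y = 0 then v.p y
  else v.p y + 1

theorem linInd_of_shear {E : Type*} [AddCommGroup E] [Module ℂ E] (u u' : X → E) (x : X)
    (hu : LinearIndependent ℂ u) (hx : u' x = -u x)
    (hy : ∀ y, y ≠ x → ∃ c : ℂ, u' y = u y + c • u x) : LinearIndependent ℂ u' := by
  choose c hc using hy
  let d : X → ℂ := fun y => if hyx : y = x then 0 else c y hyx
  have h1 : LinearIndependent ℂ (u + (d · • u x)) :=
    (linearIndependent_add_smul_iff (by simp [d])).2 hu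
  have h2 := h1.units_smul (fun y => if y = x then (-1 : ℂˣ) else 1)
  convert h2 using 1
  funext y
  by_cases hyx : y = x
  · subst hyx
    simp [d, hx]
  · simp [d, hyx, hc y hyx]

/-- The root datum obtained from `v` by the reflexion `r_x` (meaningful when `x` is reflectable
at `v`). -/
noncomputable def reflexion (v : SuperRootDatum X h) (x : X) : SuperRootDatum X h where
  a := v.reflA x
  b := v.reflB x
  p := v.reflP x
  linInd_a := by
    refine linInd_of_shear v.a _ x v.linInd_a ?_ fun y hy => ?_
    · by_cases h0 : v.cartan x x = 0
      · simp [reflA, h0]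
      · simp only [reflA, h0, ne_eq, not_false_eq_true, if_true, mul_div_assoc, div_self, two_smul,
          mul_one]
        abel
    · unfold reflA
      split_ifs
      · exact ⟨-(2 * v.cartan y x / v.cartan x x), by rw [neg_smul, sub_eq_add_neg]⟩
      · exact ⟨0, by simp⟩
      · exact ⟨_, rfl⟩
  linInd_b := by
    refine linInd_of_shear v.b _ x v.linInd_b ?_ fun y hy => ?_
    · by_cases h0 : v.cartan x x = 0
      · simp [reflB, h0]
      · simp only [reflB, h0, ne_eq, not_false_eq_true, if_true, mul_div_assoc, div_self, two_smul,
          mul_one]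
        abel
    · unfold reflB
      split_ifs
      · exact ⟨-(2 * v.cartan x y / v.cartan x x), by rw [neg_smul, sub_eq_add_neg]⟩
      · exact ⟨0, by simp⟩
      · exact ⟨1, by simp⟩

end Reflexion

/-- The target of the tautological arrow given by `θ`: `a' = θ ∘ a`, `b' = b ∘ θ⁻¹`. -/
def transport (v : SuperRootDatum X h) (θ : h ≃ₗ[ℂ] h) : SuperRootDatum X h where
  a := fun x => θ (v.a x)
  b := fun x => (v.b x).comp θ.symm.toLinearMap
  p := v.p
  linInd_a := v.linInd_a.map' θ.toLinearMap θ.ker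
  linInd_b := v.linInd_b.map' θ.symm.dualMap.toLinearMap θ.symm.dualMap.ker

/-- The target of the homothety given by `c : X → ℂˣ`: `a'(x) = c(x) a(x)`. -/
def scale (v : SuperRootDatum X h) (c : X → ℂˣ) : SuperRootDatum X h where
  a := fun x => (c x : ℂ) • v.a x
  b := v.b
  p := v.p
  linInd_a := v.linInd_a.units_smul c
  linInd_b := v.linInd_b

section Groupoid

variable [DecidableEq X]

/-- `IsArrow v w θ`: there is an arrow `v → w` of the root groupoid that induces the isomorphism
`θ` of the underlying spaces. The arrows are the compositions of tautological arrows, homotheties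
and reflexions, two of them being identified when they have the same source, the same target, and
induce the same isomorphism. We work with the full subgroupoid of root data on a fixed space `h`,
which loses nothing: tautological arrows move any connected root datum to one on `h`. -/
inductive IsArrow : SuperRootDatum X h → SuperRootDatum X h → (h ≃ₗ[ℂ] h) → Prop
  | id (v : SuperRootDatum X h) : IsArrow v v (LinearEquiv.refl ℂ h)
  | comp {v w u : SuperRootDatum X h} {θ η : h ≃ₗ[ℂ] h} :
      IsArrow v w θ → IsArrow w u η → IsArrow v u (θ.trans η)
  | tautological (v : SuperRootDatum X h) (θ : h ≃ₗ[ℂ] h) : IsArrow v (v.transport θ) θ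
  | homothety (v : SuperRootDatum X h) (c : X → ℂˣ) :
      IsArrow v (v.scale c) (LinearEquiv.refl ℂ h)
  | reflexion (v : SuperRootDatum X h) (x : X) : v.Reflectable x →
      IsArrow v (v.reflexion x) (LinearEquiv.refl ℂ h)

/-- The arrows `v → w` of the root groupoid. -/
def Arrow (v w : SuperRootDatum X h) : Type u := {θ : h ≃ₗ[ℂ] h // IsArrow v w θ}

/-- Identity arrow. -/
def Arrow.id (v : SuperRootDatum X h) : Arrow v v := ⟨LinearEquiv.refl ℂ h, IsArrow.id v⟩

/-- Composition of arrows (in diagrammatic order). -/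
def Arrow.comp {v w u : SuperRootDatum X h} (f : Arrow v w) (g : Arrow w u) : Arrow v u :=
  ⟨f.1.trans g.1, IsArrow.comp f.2 g.2⟩

/-- The reflexion `r_x : v → r_x v` as an arrow. -/
def Arrow.ofReflexion (v : SuperRootDatum X h) (x : X) (hx : v.Reflectable x) :
    Arrow v (v.reflexion x) :=
  ⟨LinearEquiv.refl ℂ h, IsArrow.reflexion v x hx⟩

end Groupoid

/-- A Lie superalgebra `g` generated by `h` and elements `e_x, f_x` of parity `p(x)`, subject to
the relations below, in which `h` embeds. Equivalently: a quotient of the Lie superalgebra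
presented by these generators and relations by an ideal that meets `h` trivially. -/
structure HalfBakedQuotient (v : SuperRootDatum X h) where
  alg : LieSuperalgebra.{u}
  ι : h →ₗ[ℂ] alg.carrier
  e : X → alg.carrier
  f : X → alg.carrier
  ι_injective : Function.Injective ι
  ι_mem : ∀ t, ι t ∈ alg.grade 0
  e_mem : ∀ x, e x ∈ alg.grade (v.p x)
  f_mem : ∀ x, f x ∈ alg.grade (v.p x)
  bracket_ι_ι : ∀ s t, alg.bracket (ι s) (ι t) = 0
  bracket_ι_e : ∀ t x, alg.bracket (ι t) (e x) = v.b x t • e x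
  bracket_ι_f : ∀ t x, alg.bracket (ι t) (f x) = -(v.b x t • f x)
  bracket_e_f_same : ∀ x, alg.bracket (e x) (f x) = ι (v.a x)
  bracket_e_f_ne : ∀ x y, x ≠ y → alg.bracket (e x) (f y) = 0
  generates : ∀ S : Submodule ℂ alg.carrier, (∀ t, ι t ∈ S) → (∀ x, e x ∈ S) → (∀ x, f x ∈ S) →
    (∀ s ∈ S, ∀ t ∈ S, alg.bracket s t ∈ S) → S = ⊤

variable [DecidableEq X]

/-- `v` is admissible: the connected component of `v` in the root groupoid carries a root
algebra, i.e. a choice of a quotient `g(w)` as above for every `w` in the component such that,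
for each arrow `w → w'`, the induced isomorphism of the underlying spaces extends to an
isomorphism `g(w) ≅ g(w')`. -/
def Admissible (v : SuperRootDatum X h) : Prop :=
  ∃ g : ∀ w : SuperRootDatum X h, Nonempty (Arrow v w) → HalfBakedQuotient w,
    ∀ (w w' : SuperRootDatum X h) (hw : Nonempty (Arrow v w)) (hw' : Nonempty (Arrow v w'))
      (γ : Arrow w w'),
      ∃ φ : LieSuperalgebra.Iso (g w hw).alg (g w' hw').alg,
        ∀ t : h, φ.toEquiv ((g w hw).ι t) = (g w' hw').ι (γ.1 t)

/-- `IsPath v [x₁, …, xₙ]`: the sequence of reflexions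
`v → r_{x₁} v → ⋯ → r_{xₙ} ⋯ r_{x₁} v` is defined. -/
def IsPath (v : SuperRootDatum X h) : List X → Prop
  | [] => True
  | x :: l => v.Reflectable x ∧ (v.reflexion x).IsPath l

/-- The final vertex of the path of reflexions that starts at `v` and is labelled by the list. -/
noncomputable def pathEnd (v : SuperRootDatum X h) : List X → SuperRootDatum X h
  | [] => v
  | x :: l => (v.reflexion x).pathEnd l

/-- The composition, in the root groupoid, of a path of reflexions. -/
noncomputable def pathArrow : (v : SuperRootDatum X h) → (l : List X) → v.IsPath l →
    Arrow v (v.pathEnd l)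
  | v, [], _ => Arrow.id v
  | v, x :: l, hl => (Arrow.ofReflexion v x hl.1).comp (pathArrow (v.reflexion x) l hl.2)

/-- The vertices of the skeleton `Sk(v)`: the root data reached from `v` by reflexions. -/
def skeleton (v : SuperRootDatum X h) : Set (SuperRootDatum X h) :=
  {w | ∃ l, v.IsPath l ∧ v.pathEnd l = w}

/-- The path of reflexions labelled by `l` from `v` to its end is a shortest path in the
skeleton. -/
def IsShortest (v : SuperRootDatum X h) (l : List X) : Prop :=
  v.IsPath l ∧ ∀ l', v.IsPath l' → v.pathEnd l' = v.pathEnd l → l.length ≤ l'.length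

end SuperRootDatum

/-! Admissibility enters only through roots. Isomorphisms extending the identity of `h` match weight
spaces, so the root data joined to `v` by reflexions share one set `Δ` of nonzero weights, which
each of them splits into positive and negative. The weight spaces of `b x` and `-b x` are the lines
of `e x` and `f x`, so a simple root determines its parity, and its coroot up to a scalar. An
anisotropic reflexion is moreover the tautological arrow of a linear reflection of `h`, which
therefore preserves `Δ`. `CommonRoots` records these facts; no other property of the superalgebras
is used.

The rest is in the style of Coxeter groups. Among the simple roots of all members of the class, a
reflexion at `x` changes the sign of `±b x` only. So `separation`, the number of reflectable roots
separating two vertices, changes by exactly one at each step and bounds the length of a path from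
below. The key fact `walk_separation` is that this bound is attained. A path too long is reduced to
one that crosses a root at its first step and again at its last, and the crossing is pushed through
a residue of rank two (the vertices reached with two labels). There, vertices with separation zero
coincide (`eq_of_walk_pair`): the change of simple roots and its inverse have nonnegative entries,
and the determinant is one by parity.

Finally let `β` be the root `b y` at `v₀`. If `r_y` destroys minimality, `β` is negative at the end
of the path, so some step `r_{x_j}` crosses it: `β` is the simple root at `x_j` of `v_{j-1}`. The
coroots being proportional, both reflexions are given by the same linear reflection `s`. Since `v₀'
= s v₀`, applying `s` to the path up to `v_{j-1}` gives the namesake path, and it ends at `s v_{j-1}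
= v_j`. All arrows involved induce the identity of `h`, so the compositions coincide. -/

theorem LinearIndependent.exists_linearMap_apply_eq {X E : Type*} [AddCommGroup E] [Module ℂ E]
    {e : X → E} (he : LinearIndependent ℂ e) (k : X → ℂ) :
    ∃ c : E →ₗ[ℂ] ℂ, ∀ x, c (e x) = k x := by
  obtain ⟨c, hc⟩ := LinearMap.exists_extend ((Module.Basis.span he).constr ℂ k)
  refine ⟨c, fun x => ?_⟩
  have h1 := LinearMap.congr_fun hc (Module.Basis.span he x)
  rw [Module.Basis.constr_basis] at h1
  simpa [Module.Basis.span_apply] using h1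

theorem LinearMap.map_list_sum_of_const {X E : Type*} [AddCommGroup E] [Module ℂ E]
    (c : E →ₗ[ℂ] ℂ) {u : X → E} {k : ℂ} (hc : ∀ x, c (u x) = k) (l : List X) :
    c (l.map u).sum = l.length * k := by
  induction l with
  | nil => simp
  | cons y l ih => simp [ih, hc]; ring

/-! ### Weight spaces of a half-baked quotient. -/

namespace SuperRootDatum

namespace HalfBakedQuotient

variable {X : Type v} {h : Type u} [AddCommGroup h] [Module ℂ h] {w : SuperRootDatum X h}
  (H : HalfBakedQuotient w)

/-- The weight space of `α` in the adjoint action of `h`. -/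
def weightSpace (α : Module.Dual ℂ h) : Submodule ℂ H.alg.carrier where
  carrier := {s | ∀ t, H.alg.bracket (H.ι t) s = α t • s}
  add_mem' := by
    intro s r hs hr t
    rw [map_add, hs t, hr t, smul_add]
  zero_mem' := by simp
  smul_mem' := by
    intro c s hs t
    rw [map_smul, hs t, smul_comm]

theorem bracket_ι_comm (s t : h) (r : H.alg.carrier) :
    H.alg.bracket (H.ι s) (H.alg.bracket (H.ι t) r) =
      H.alg.bracket (H.ι t) (H.alg.bracket (H.ι s) r) := by
  have h1 := H.alg.jacobi 0 0 _ _ r (H.ι_mem s) (H.ι_mem t)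
  simpa [H.bracket_ι_ι] using h1

/-- The operators of `h` commute, so their simultaneous generalized eigenspaces are independent;
weight spaces sit inside these, without any finiteness of dimension. -/
theorem disjoint_weightSpace (α : Module.Dual ℂ h) :
    Disjoint (H.weightSpace α) (⨆ β : {β // β ≠ α}, H.weightSpace β) := by
  have hind := Module.End.independent_iInf_maxGenEigenspace_of_forall_mapsTo
    (fun t : h => H.alg.bracket (H.ι t)) (fun s t χ => Module.End.mapsTo_maxGenEigenspace_of_comm
      (LinearMap.ext fun r => H.bracket_ι_comm t s r) χ)
  have hle : ∀ β : Module.Dual ℂ h, H.weightSpace β ≤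
      ⨅ t, Module.End.maxGenEigenspace (H.alg.bracket (H.ι t)) (β t) := by
    intro β s hs
    rw [Module.End.mem_iInf_maxGenEigenspace_iff (f := fun t : h => H.alg.bracket (H.ι t))]
    intro t
    refine ⟨1, ?_⟩
    simp [hs t]
  refine (hind (fun t => α t)).mono (hle α) ?_
  refine iSup_le fun β => (hle β).trans ?_
  refine le_iSup_of_le (fun t => (β : Module.Dual ℂ h) t) (le_iSup_of_le ?_ le_rfl)
  intro hβ
  exact β.2 (LinearMap.ext fun t => congrFun hβ t)

/-- A weight vector lies in the span of the members of its weight of any spanning family of weight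
vectors. -/
theorem weightSpace_le_span {I : Type*} {m : I → H.alg.carrier} {γ : I → Module.Dual ℂ h}
    (hm : ∀ i, m i ∈ H.weightSpace (γ i)) (htop : Submodule.span ℂ (Set.range m) = ⊤)
    (α : Module.Dual ℂ h) : H.weightSpace α ≤ Submodule.span ℂ (m '' {i | γ i = α}) := by
  intro s hs
  have hs' : s ∈ Submodule.span ℂ (m '' {i | γ i = α}) ⊔
      Submodule.span ℂ (m '' {i | γ i ≠ α}) := by
    rw [← Submodule.span_union, ← Set.image_union]
    have : {i | γ i = α} ∪ {i | γ i ≠ α} = Set.univ := by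
      ext i; simpa using em _
    rw [this, Set.image_univ, htop]
    trivial
  obtain ⟨q, hq, r, hr, rfl⟩ := Submodule.mem_sup.1 hs'
  have hqα : q ∈ H.weightSpace α := by
    refine Submodule.span_le.2 ?_ hq
    rintro _ ⟨i, hi, rfl⟩
    have := hm i
    rwa [show γ i = α from hi] at this
  have hrα : r ∈ H.weightSpace α := by
    simpa using (H.weightSpace α).sub_mem hs hqα
  have hr2 : r ∈ ⨆ β : {β // β ≠ α}, H.weightSpace β := by
    refine Submodule.span_le.2 ?_ hr
    rintro _ ⟨i, hi, rfl⟩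
    exact Submodule.mem_iSup_of_mem (⟨γ i, hi⟩ : {β // β ≠ α}) (hm i)
  have := Submodule.disjoint_def.1 (H.disjoint_weightSpace α) r hrα hr2
  simpa [this] using hq

/-- The iterated bracket `[e_{l₁}, [e_{l₂}, … e_x]]`. -/
def iterBracket (e : X → H.alg.carrier) (x : X) (l : List X) : H.alg.carrier :=
  l.foldr (fun y s => H.alg.bracket (e y) s) (e x)

section Triangular

variable {H} {e f : X → H.alg.carrier} {p : X → ZMod 2} {β : X → Module.Dual ℂ h}

theorem iterBracket_mem_weightSpace (he : ∀ x, e x ∈ H.alg.grade (p x))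
    (hβ : ∀ x, e x ∈ H.weightSpace (β x)) (x : X) (l : List X) :
    H.iterBracket e x l ∈ H.weightSpace (β x + (l.map β).sum) := by
  induction l with
  | nil => simpa [iterBracket] using hβ x
  | cons y l ih =>
    intro t
    have h1 := H.alg.jacobi 0 (p y) _ _ (H.iterBracket e x l) (H.ι_mem t) (he y)
    have h2 := ih t
    change H.alg.bracket (H.ι t) (H.alg.bracket (e y) (H.iterBracket e x l)) =
      _ • H.alg.bracket (e y) (H.iterBracket e x l)
    rw [h1, hβ y t, h2]
    simp only [ZMod.val_zero, zero_mul, pow_zero, one_smul, map_smul, LinearMap.smul_apply,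
      List.map_cons, List.sum_cons, LinearMap.add_apply]
    module

theorem bracket_ι_mem_of_weight (he : ∀ x, e x ∈ H.alg.grade (p x))
    (hβ : ∀ x, e x ∈ H.weightSpace (β x)) (t : h) {s : H.alg.carrier}
    (hs : s ∈ Submodule.span ℂ (Set.range fun i : X × List X => H.iterBracket e i.1 i.2)) :
    H.alg.bracket (H.ι t) s ∈
      Submodule.span ℂ (Set.range fun i : X × List X => H.iterBracket e i.1 i.2) := by
  induction hs using Submodule.span_induction with
  | mem s hs =>
    obtain ⟨i, rfl⟩ := hs
    rw [iterBracket_mem_weightSpace he hβ i.1 i.2 t]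
    exact Submodule.smul_mem _ _ (Submodule.subset_span ⟨i, rfl⟩)
  | zero => simp
  | add s r _ _ hs hr => rw [map_add]; exact Submodule.add_mem _ hs hr
  | smul c s _ hs => rw [map_smul]; exact Submodule.smul_mem _ _ hs

theorem bracket_raise_mem (x : X) {s : H.alg.carrier}
    (hs : s ∈ Submodule.span ℂ (Set.range fun i : X × List X => H.iterBracket e i.1 i.2)) :
    H.alg.bracket (e x) s ∈
      Submodule.span ℂ (Set.range fun i : X × List X => H.iterBracket e i.1 i.2) := by
  induction hs using Submodule.span_induction with
  | mem s hs =>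
    obtain ⟨i, rfl⟩ := hs
    exact Submodule.subset_span ⟨(i.1, x :: i.2), rfl⟩
  | zero => simp
  | add s r _ _ hs hr => rw [map_add]; exact Submodule.add_mem _ hs hr
  | smul c s _ hs => rw [map_smul]; exact Submodule.smul_mem _ _ hs

theorem bracket_raise_ι_mem (he : ∀ x, e x ∈ H.alg.grade (p x))
    (hβ : ∀ x, e x ∈ H.weightSpace (β x)) (x : X) (t : h) :
    H.alg.bracket (e x) (H.ι t) ∈
      Submodule.span ℂ (Set.range fun i : X × List X => H.iterBracket e i.1 i.2) := by
  rw [H.alg.bracket_skew (p x) 0 _ _ (he x) (H.ι_mem t), hβ x t]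
  exact Submodule.neg_mem _ (Submodule.smul_mem _ _ (Submodule.smul_mem _ _
    (Submodule.subset_span ⟨(x, []), rfl⟩)))

/-- By Jacobi, `[f_y, [e_z, s]]` is `[[f_y, e_z], s]`, where `[f_y, e_z]` lies in `h` and acts on
`s` by a scalar, plus or minus `[e_z, [f_y, s]]`, handled by induction. The families `e` and `f` are
arbitrary so that their roles can be exchanged. -/
theorem bracket_lower_mem (he : ∀ x, e x ∈ H.alg.grade (p x))
    (hf : ∀ x, f x ∈ H.alg.grade (p x)) (hβ : ∀ x, e x ∈ H.weightSpace (β x))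
    (hef : ∀ x y, H.alg.bracket (f y) (e x) ∈ LinearMap.range H.ι) (y : X) {s : H.alg.carrier}
    (hs : s ∈ Submodule.span ℂ (Set.range fun i : X × List X => H.iterBracket e i.1 i.2)) :
    H.alg.bracket (f y) s ∈ LinearMap.range H.ι ⊔
      Submodule.span ℂ (Set.range fun i : X × List X => H.iterBracket e i.1 i.2) := by
  induction hs using Submodule.span_induction with
  | mem s hs =>
    obtain ⟨⟨x, l⟩, rfl⟩ := hs
    induction l with
    | nil => exact Submodule.mem_sup_left (hef x y)
    | cons z l ih =>
      change H.alg.bracket (f y) (H.alg.bracket (e z) (H.iterBracket e x l)) ∈ _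
      rw [H.alg.jacobi _ _ _ _ _ (hf y) (he z)]
      obtain ⟨t, ht⟩ := hef z y
      refine Submodule.mem_sup_right (Submodule.add_mem _ ?_ (Submodule.smul_mem _ _ ?_))
      · rw [← ht]
        exact bracket_ι_mem_of_weight he hβ t (Submodule.subset_span ⟨(x, l), rfl⟩)
      · obtain ⟨_, ⟨t', rfl⟩, r, hr, hsum⟩ := Submodule.mem_sup.1 ih
        dsimp only at hsum
        rw [← hsum, map_add]
        exact Submodule.add_mem _ (bracket_raise_ι_mem he hβ z t') (bracket_raise_mem z hr)
  | zero => simp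
  | add s r _ _ hs hr => rw [map_add]; exact Submodule.add_mem _ hs hr
  | smul c s _ hs => rw [map_smul]; exact Submodule.smul_mem _ _ hs

end Triangular

/-- A subspace that contains the generators and is stable under their adjoint action is the
whole algebra. -/
theorem eq_top_of_stable (S : Submodule ℂ H.alg.carrier) (hι : ∀ t, H.ι t ∈ S)
    (he : ∀ x, H.e x ∈ S) (hf : ∀ x, H.f x ∈ S)
    (sι : ∀ t, ∀ s ∈ S, H.alg.bracket (H.ι t) s ∈ S)
    (se : ∀ x, ∀ s ∈ S, H.alg.bracket (H.e x) s ∈ S)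
    (sf : ∀ x, ∀ s ∈ S, H.alg.bracket (H.f x) s ∈ S) : S = ⊤ := by
  let N : Submodule ℂ H.alg.carrier :=
    { carrier := {r | ∀ s ∈ S, H.alg.bracket r s ∈ S}
      add_mem' := fun {a b} ha hb s hs => by
        rw [map_add, LinearMap.add_apply]; exact S.add_mem (ha s hs) (hb s hs)
      zero_mem' := fun s _ => by simp
      smul_mem' := fun c a ha s hs => by
        rw [map_smul, LinearMap.smul_apply]; exact S.smul_mem c (ha s hs) }
  -- The Jacobi identity concerns homogeneous elements, so generation is applied to the sum of the
  -- homogeneous parts of the stabilizer `N` of `S`, which is closed under the bracket.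
  have key : (⨆ i, N ⊓ H.alg.grade i) = ⊤ := by
    refine H.generates _ (fun t => ?_) (fun x => ?_) (fun x => ?_) ?_
    · exact Submodule.mem_iSup_of_mem 0 ⟨fun s hs => sι t s hs, H.ι_mem t⟩
    · exact Submodule.mem_iSup_of_mem (w.p x) ⟨fun s hs => se x s hs, H.e_mem x⟩
    · exact Submodule.mem_iSup_of_mem (w.p x) ⟨fun s hs => sf x s hs, H.f_mem x⟩
    · intro s hs t ht
      induction hs using Submodule.iSup_induction' with
      | mem i s hs =>
        induction ht using Submodule.iSup_induction' with
        | mem j t ht =>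
          refine Submodule.mem_iSup_of_mem (i + j) ⟨fun r hr => ?_,
            H.alg.bracket_mem i j s t hs.2 ht.2⟩
          have h1 := H.alg.jacobi i j s t r hs.2 ht.2
          rw [← sub_eq_iff_eq_add] at h1
          rw [← h1]
          exact S.sub_mem (hs.1 _ (ht.1 r hr)) (S.smul_mem _ (ht.1 _ (hs.1 r hr)))
        | zero => simp
        | add a b _ _ ha hb => rw [map_add]; exact Submodule.add_mem _ ha hb
      | zero => simp
      | add a b _ _ ha hb =>
        rw [map_add, LinearMap.add_apply]; exact Submodule.add_mem _ ha hb
  have hN : N = ⊤ := top_le_iff.1 (key ▸ iSup_le fun i => inf_le_left)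
  refine H.generates S hι he hf fun s _ t ht => ?_
  have : s ∈ N := hN ▸ Submodule.mem_top
  exact this t ht

/-- The spanning family of weight vectors: `h` and the iterated brackets of the `e_x` and of the
`f_x`. -/
def monomial : h ⊕ (X × List X) ⊕ (X × List X) → H.alg.carrier
  | .inl t => H.ι t
  | .inr (.inl i) => H.iterBracket H.e i.1 i.2
  | .inr (.inr i) => H.iterBracket H.f i.1 i.2

/-- The weights of the members of `monomial`. -/
def monomialWeight (w : SuperRootDatum X h) : h ⊕ (X × List X) ⊕ (X × List X) → Module.Dual ℂ h
  | .inl _ => 0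
  | .inr (.inl i) => w.b i.1 + (i.2.map w.b).sum
  | .inr (.inr i) => -w.b i.1 + (i.2.map fun x => -w.b x).sum

theorem e_mem_weightSpace (x : X) : H.e x ∈ H.weightSpace (w.b x) := fun t => H.bracket_ι_e t x

theorem f_mem_weightSpace (x : X) : H.f x ∈ H.weightSpace (-w.b x) := fun t => by
  rw [H.bracket_ι_f t x, LinearMap.neg_apply, neg_smul]

theorem monomial_mem_weightSpace (i : h ⊕ (X × List X) ⊕ (X × List X)) :
    H.monomial i ∈ H.weightSpace (monomialWeight w i) := by
  rcases i with t | i | i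
  · intro s
    simp [monomial, monomialWeight, H.bracket_ι_ι]
  · exact iterBracket_mem_weightSpace H.e_mem H.e_mem_weightSpace _ _
  · exact iterBracket_mem_weightSpace H.f_mem H.f_mem_weightSpace _ _

theorem bracket_f_e_mem (x y : X) : H.alg.bracket (H.f y) (H.e x) ∈ LinearMap.range H.ι := by
  rw [H.alg.bracket_skew _ _ _ _ (H.f_mem y) (H.e_mem x)]
  by_cases hxy : x = y
  · subst hxy
    rw [H.bracket_e_f_same]
    exact Submodule.neg_mem _ (Submodule.smul_mem _ _ ⟨_, rfl⟩)
  · rw [H.bracket_e_f_ne x y hxy]; simp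

theorem bracket_e_f_mem (x y : X) : H.alg.bracket (H.e y) (H.f x) ∈ LinearMap.range H.ι := by
  by_cases hxy : y = x
  · subst hxy
    rw [H.bracket_e_f_same]
    exact ⟨_, rfl⟩
  · rw [H.bracket_e_f_ne y x hxy]; simp

/-- Triangular decomposition: `h` together with the iterated brackets of the `e x` alone and of the
`f x` alone is stable under all generators. -/
theorem span_monomial : Submodule.span ℂ (Set.range H.monomial) = ⊤ := by
  set P := Submodule.span ℂ (Set.range fun i : X × List X => H.iterBracket H.e i.1 i.2) with hP
  set Q := Submodule.span ℂ (Set.range fun i : X × List X => H.iterBracket H.f i.1 i.2) with hQ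
  set R := LinearMap.range H.ι with hR
  have hsplit : (R ⊔ P) ⊔ Q ≤ Submodule.span ℂ (Set.range H.monomial) := by
    refine sup_le (sup_le ?_ ?_) ?_
    · rintro _ ⟨t, rfl⟩
      exact Submodule.subset_span ⟨.inl t, rfl⟩
    · refine Submodule.span_mono ?_
      rintro _ ⟨i, rfl⟩
      exact ⟨.inr (.inl i), rfl⟩
    · refine Submodule.span_mono ?_
      rintro _ ⟨i, rfl⟩
      exact ⟨.inr (.inr i), rfl⟩
  have hRS : R ≤ (R ⊔ P) ⊔ Q := le_sup_left.trans le_sup_left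
  have hPS : P ≤ (R ⊔ P) ⊔ Q := le_sup_right.trans le_sup_left
  have hQS : Q ≤ (R ⊔ P) ⊔ Q := le_sup_right
  have hRQ : R ⊔ Q ≤ (R ⊔ P) ⊔ Q := sup_le hRS hQS
  have main : ∀ a : H.alg.carrier, (∀ t, H.alg.bracket a (H.ι t) ∈ (R ⊔ P) ⊔ Q) →
      (∀ s ∈ P, H.alg.bracket a s ∈ (R ⊔ P) ⊔ Q) → (∀ s ∈ Q, H.alg.bracket a s ∈ (R ⊔ P) ⊔ Q) →
      ∀ s ∈ (R ⊔ P) ⊔ Q, H.alg.bracket a s ∈ (R ⊔ P) ⊔ Q := by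
    intro a h1 h2 h3 s hs
    obtain ⟨_, hr, q, hq, rfl⟩ := Submodule.mem_sup.1 hs
    obtain ⟨_, ⟨t, rfl⟩, p, hp, rfl⟩ := Submodule.mem_sup.1 hr
    rw [map_add, map_add]
    exact Submodule.add_mem _ (Submodule.add_mem _ (h1 t) (h2 p hp)) (h3 q hq)
  refine top_le_iff.1 (le_trans (top_le_iff.2 (H.eq_top_of_stable ((R ⊔ P) ⊔ Q) ?_ ?_ ?_ ?_ ?_ ?_))
    hsplit)
  · exact fun t => hRS ⟨t, rfl⟩
  · exact fun x => hPS (Submodule.subset_span ⟨(x, []), rfl⟩)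
  · exact fun x => hQS (Submodule.subset_span ⟨(x, []), rfl⟩)
  · intro t
    refine main _ (fun s => by rw [H.bracket_ι_ι]; exact zero_mem _) (fun s hs => ?_)
      fun s hs => ?_
    · exact hPS (bracket_ι_mem_of_weight H.e_mem H.e_mem_weightSpace t hs)
    · exact hQS (bracket_ι_mem_of_weight H.f_mem H.f_mem_weightSpace t hs)
  · intro x
    refine main _ (fun t => ?_) (fun s hs => ?_) fun s hs => ?_
    · exact hPS (bracket_raise_ι_mem H.e_mem H.e_mem_weightSpace x t)
    · exact hPS (bracket_raise_mem x hs)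
    · exact hRQ (bracket_lower_mem H.f_mem H.e_mem H.f_mem_weightSpace
        (fun x y => H.bracket_e_f_mem x y) x hs)
  · intro x
    refine main _ (fun t => ?_) (fun s hs => ?_) fun s hs => ?_
    · exact hQS (bracket_raise_ι_mem H.f_mem H.f_mem_weightSpace x t)
    · exact (le_sup_left : R ⊔ P ≤ _) (bracket_lower_mem H.e_mem H.f_mem H.e_mem_weightSpace
        (fun x y => H.bracket_f_e_mem x y) x hs)
    · exact hQS (bracket_raise_mem x hs)

theorem weightSpace_le_span_monomial (α : Module.Dual ℂ h) : H.weightSpace α ≤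
    Submodule.span ℂ (H.monomial '' {i | monomialWeight w i = α}) :=
  H.weightSpace_le_span H.monomial_mem_weightSpace H.span_monomial α

/-- The height functional `c`, equal to one on every simple root, separates monomials by length:
among those of height one, only `e x` itself has weight `b x`, by linear independence. -/
theorem weightSpace_b_le (x : X) : H.weightSpace (w.b x) ≤ Submodule.span ℂ {H.e x} := by
  refine (H.weightSpace_le_span_monomial _).trans (Submodule.span_mono ?_)
  obtain ⟨c, hc⟩ := w.linInd_b.exists_linearMap_apply_eq fun _ => 1
  have hsum := c.map_list_sum_of_const hc
  have hsum' := c.map_list_sum_of_const (u := fun x => -w.b x) (k := -1) fun x => by simp [hc]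
  rintro _ ⟨t | ⟨y, l⟩ | ⟨y, l⟩, hi, rfl⟩
  · have := congrArg c (show (0 : Module.Dual ℂ h) = w.b x from hi)
    simp [hc] at this
  · have h1 : w.b y + (l.map w.b).sum = w.b x := hi
    have h2 := congrArg c h1
    rw [map_add, hsum, hc, hc] at h2
    have h3 : l = [] := by
      rw [← List.length_eq_zero_iff]
      exact_mod_cast (by simpa using h2 : (l.length : ℂ) = 0)
    subst h3
    have h4 : y = x := w.linInd_b.injective (by simpa using h1)
    subst h4
    rfl
  · have h1 : -w.b y + (l.map fun x => -w.b x).sum = w.b x := hi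
    have h2 := congrArg c h1
    rw [map_add, hsum', map_neg, hc, hc] at h2
    exfalso
    have h3 : ((l.length + 2 : ℕ) : ℂ) = 0 := by push_cast; linear_combination -h2
    exact absurd (Nat.cast_eq_zero.1 h3) (by omega)

theorem weightSpace_neg_b_le (x : X) : H.weightSpace (-w.b x) ≤ Submodule.span ℂ {H.f x} := by
  refine (H.weightSpace_le_span_monomial _).trans (Submodule.span_mono ?_)
  obtain ⟨c, hc⟩ := w.linInd_b.exists_linearMap_apply_eq fun _ => 1
  have hsum := c.map_list_sum_of_const hc
  have hsum' := c.map_list_sum_of_const (u := fun x => -w.b x) (k := -1) fun x => by simp [hc]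
  rintro _ ⟨t | ⟨y, l⟩ | ⟨y, l⟩, hi, rfl⟩
  · have := congrArg c (show (0 : Module.Dual ℂ h) = -w.b x from hi)
    simp [hc] at this
  · have h1 : w.b y + (l.map w.b).sum = -w.b x := hi
    have h2 := congrArg c h1
    rw [map_add, hsum, map_neg, hc, hc] at h2
    exfalso
    have h3 : ((l.length + 2 : ℕ) : ℂ) = 0 := by push_cast; linear_combination h2
    exact absurd (Nat.cast_eq_zero.1 h3) (by omega)
  · have h1 : -w.b y + (l.map fun x => -w.b x).sum = -w.b x := hi
    have h2 := congrArg c h1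
    rw [map_add, hsum', map_neg, map_neg, hc, hc] at h2
    have h3 : l = [] := by
      rw [← List.length_eq_zero_iff]
      exact_mod_cast (by simpa using h2 : (l.length : ℂ) = 0)
    subst h3
    have h4 : y = x := w.linInd_b.injective (by simpa using h1)
    subst h4
    rfl

end HalfBakedQuotient

end SuperRootDatum

/-! ### Reflexions are involutive. -/

namespace SuperRootDatum

variable {X : Type v} {h : Type u} [AddCommGroup h] [Module ℂ h] [DecidableEq X]
  (w : SuperRootDatum X h) (x : X)

theorem reflexion_a_self : (w.reflexion x).a x = -w.a x := by
  change w.reflA x x = _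
  by_cases h0 : w.cartan x x = 0
  · simp [reflA, h0]
  · rw [reflA, if_pos h0, mul_div_cancel_right₀ _ h0]
    module

theorem reflexion_b_self : (w.reflexion x).b x = -w.b x := by
  change w.reflB x x = _
  by_cases h0 : w.cartan x x = 0
  · simp [reflB, h0]
  · rw [reflB, if_pos h0, mul_div_cancel_right₀ _ h0]
    module

theorem reflexion_p_self : (w.reflexion x).p x = w.p x := by
  change w.reflP x x = _
  simp [reflP]

variable {w x}

theorem reflexion_a_of_anisotropic (hx : w.Anisotropic x) (y : X) :
    (w.reflexion x).a y = w.a y - (2 * w.cartan y x / w.cartan x x) • w.a x := if_pos hx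

theorem reflexion_b_of_anisotropic (hx : w.Anisotropic x) (y : X) :
    (w.reflexion x).b y = w.b y - (2 * w.cartan x y / w.cartan x x) • w.b x := if_pos hx

theorem reflexion_p_of_anisotropic (hx : w.Anisotropic x) (y : X) :
    (w.reflexion x).p y = w.p y := if_pos hx

section Isotropic

variable {y : X} (h0 : w.cartan x x = 0) (hyx : y ≠ x)

include h0 hyx

theorem reflexion_a_of_isotropic_of_eq (hxy : w.cartan x y = 0) :
    (w.reflexion x).a y = w.a y := by
  change w.reflA x y = _
  simp [reflA, h0, hyx, hxy]

theorem reflexion_b_of_isotropic_of_eq (hxy : w.cartan x y = 0) :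
    (w.reflexion x).b y = w.b y := by
  change w.reflB x y = _
  simp [reflB, h0, hyx, hxy]

theorem reflexion_p_of_isotropic_of_eq (hxy : w.cartan x y = 0) :
    (w.reflexion x).p y = w.p y := by
  change w.reflP x y = _
  simp [reflP, h0, hyx, hxy]

theorem reflexion_a_of_isotropic_of_ne (hxy : w.cartan x y ≠ 0) :
    (w.reflexion x).a y = w.a y + (w.cartan y x / w.cartan x y) • w.a x := by
  change w.reflA x y = _
  simp [reflA, h0, hyx, hxy]

theorem reflexion_b_of_isotropic_of_ne (hxy : w.cartan x y ≠ 0) :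
    (w.reflexion x).b y = w.b y + w.b x := by
  change w.reflB x y = _
  simp [reflB, h0, hyx, hxy]

theorem reflexion_p_of_isotropic_of_ne (hxy : w.cartan x y ≠ 0) :
    (w.reflexion x).p y = w.p y + 1 := by
  change w.reflP x y = _
  simp [reflP, h0, hyx, hxy]

end Isotropic

theorem cartan_reflexion_self : (w.reflexion x).cartan x x = w.cartan x x := by
  rw [cartan, reflexion_a_self, reflexion_b_self]
  simp [cartan]

theorem cartan_reflexion_left_of_anisotropic (hx : w.Anisotropic x) (y : X) :
    (w.reflexion x).cartan x y = w.cartan x y := by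
  have hx' : w.b x (w.a x) ≠ 0 := hx
  rw [cartan, reflexion_a_self, reflexion_b_of_anisotropic hx]
  simp only [cartan, map_neg, LinearMap.sub_apply, LinearMap.smul_apply, smul_eq_mul]
  field_simp
  ring

theorem cartan_reflexion_right_of_anisotropic (hx : w.Anisotropic x) (y : X) :
    (w.reflexion x).cartan y x = w.cartan y x := by
  have hx' : w.b x (w.a x) ≠ 0 := hx
  rw [cartan, reflexion_b_self, reflexion_a_of_anisotropic hx]
  simp only [cartan, map_sub, LinearMap.neg_apply, map_smul, smul_eq_mul]
  field_simp
  ring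

theorem cartan_reflexion_left_of_isotropic (h0 : w.cartan x x = 0) {y : X} (hyx : y ≠ x) :
    (w.reflexion x).cartan x y = -w.cartan x y := by
  have h0' : w.b x (w.a x) = 0 := h0
  by_cases hxy : w.cartan x y = 0
  · rw [cartan, reflexion_a_self, reflexion_b_of_isotropic_of_eq h0 hyx hxy, map_neg]; rfl
  · rw [cartan, reflexion_a_self, reflexion_b_of_isotropic_of_ne h0 hyx hxy, map_neg,
      LinearMap.add_apply, h0', add_zero]; rfl

theorem cartan_reflexion_right_of_isotropic (h0 : w.cartan x x = 0) {y : X} (hyx : y ≠ x) :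
    (w.reflexion x).cartan y x = -w.cartan y x := by
  have h0' : w.b x (w.a x) = 0 := h0
  by_cases hxy : w.cartan x y = 0
  · rw [cartan, reflexion_b_self, reflexion_a_of_isotropic_of_eq h0 hyx hxy]; rfl
  · rw [cartan, reflexion_b_self, reflexion_a_of_isotropic_of_ne h0 hyx hxy, LinearMap.neg_apply,
      map_add, map_smul, h0', smul_zero, add_zero]; rfl

theorem Reflectable.reflexion (hx : w.Reflectable x) : (w.reflexion x).Reflectable x := by
  refine ⟨fun h0 => ?_, fun h0 hp y hy => ?_, fun h0 hp y hy => ?_⟩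
  · rw [cartan_reflexion_self] at h0
    rw [reflexion_p_self, hx.1 h0]
  · rw [cartan_reflexion_self] at h0 ⊢
    rw [reflexion_p_self] at hp
    rw [cartan_reflexion_left_of_anisotropic h0]
    exact hx.2.1 h0 hp y hy
  · rw [cartan_reflexion_self] at h0 ⊢
    rw [reflexion_p_self] at hp
    rw [cartan_reflexion_left_of_anisotropic h0]
    exact hx.2.2 h0 hp y hy

variable (w x)

theorem reflexion_reflexion : (w.reflexion x).reflexion x = w := by
  by_cases h0 : w.cartan x x = 0
  · have h0' : (w.reflexion x).cartan x x = 0 := by rw [cartan_reflexion_self, h0]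
    have key : ∀ y, ((w.reflexion x).reflexion x).a y = w.a y ∧
        ((w.reflexion x).reflexion x).b y = w.b y ∧
        ((w.reflexion x).reflexion x).p y = w.p y := by
      intro y
      by_cases hyx : y = x
      · subst hyx
        rw [reflexion_a_self, reflexion_a_self, reflexion_b_self, reflexion_b_self,
          reflexion_p_self, reflexion_p_self, neg_neg, neg_neg]
        exact ⟨rfl, rfl, rfl⟩
      by_cases hxy : w.cartan x y = 0
      · have hxy' : (w.reflexion x).cartan x y = 0 := by
          rw [cartan_reflexion_left_of_isotropic h0 hyx, hxy, neg_zero]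
        rw [reflexion_a_of_isotropic_of_eq h0' hyx hxy', reflexion_b_of_isotropic_of_eq h0' hyx hxy',
          reflexion_p_of_isotropic_of_eq h0' hyx hxy', reflexion_a_of_isotropic_of_eq h0 hyx hxy,
          reflexion_b_of_isotropic_of_eq h0 hyx hxy, reflexion_p_of_isotropic_of_eq h0 hyx hxy]
        exact ⟨rfl, rfl, rfl⟩
      · have hxy' : (w.reflexion x).cartan x y ≠ 0 := by
          rw [cartan_reflexion_left_of_isotropic h0 hyx]
          exact neg_ne_zero.2 hxy
        rw [reflexion_a_of_isotropic_of_ne h0' hyx hxy', reflexion_b_of_isotropic_of_ne h0' hyx hxy',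
          reflexion_p_of_isotropic_of_ne h0' hyx hxy', reflexion_a_of_isotropic_of_ne h0 hyx hxy,
          reflexion_b_of_isotropic_of_ne h0 hyx hxy, reflexion_p_of_isotropic_of_ne h0 hyx hxy,
          reflexion_a_self, reflexion_b_self, cartan_reflexion_left_of_isotropic h0 hyx,
          cartan_reflexion_right_of_isotropic h0 hyx, neg_div_neg_eq]
        refine ⟨by module, by module, ?_⟩
        rw [add_assoc, show (1 + 1 : ZMod 2) = 0 by decide, add_zero]
    ext1
    · exact funext fun y => (key y).1
    · exact funext fun y => (key y).2.1
    · exact funext fun y => (key y).2.2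
  · have h0' : (w.reflexion x).Anisotropic x := by
      rwa [Anisotropic, cartan_reflexion_self]
    ext1 <;> funext y
    · rw [reflexion_a_of_anisotropic h0', reflexion_a_self, reflexion_a_of_anisotropic h0,
        cartan_reflexion_self, cartan_reflexion_right_of_anisotropic h0]
      module
    · rw [reflexion_b_of_anisotropic h0', reflexion_b_self, reflexion_b_of_anisotropic h0,
        cartan_reflexion_self, cartan_reflexion_left_of_anisotropic h0]
      module
    · rw [reflexion_p_of_anisotropic h0', reflexion_p_of_anisotropic h0]

end SuperRootDatum

/-! ### Positivity, and the roots common to a component. -/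

namespace SuperRootDatum

variable {X : Type v} {h : Type u} [AddCommGroup h] [Module ℂ h]

/-- `α` is a sum of simple roots of `w`. -/
def Pos (w : SuperRootDatum X h) (α : Module.Dual ℂ h) : Prop :=
  α ∈ AddSubmonoid.closure (Set.range w.b)

theorem pos_b (w : SuperRootDatum X h) (x : X) : w.Pos (w.b x) :=
  AddSubmonoid.subset_closure ⟨x, rfl⟩

theorem Pos.add {w : SuperRootDatum X h} {α β : Module.Dual ℂ h} (hα : w.Pos α) (hβ : w.Pos β) :
    w.Pos (α + β) := AddSubmonoid.add_mem _ hα hβ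

theorem Pos.nsmul {w : SuperRootDatum X h} {α : Module.Dual ℂ h} (hα : w.Pos α) (n : ℕ) :
    w.Pos (n • α) := AddSubmonoid.nsmul_mem _ hα n

open Classical in
theorem exists_coord (w : SuperRootDatum X h) (x : X) :
    ∃ c : Module.Dual ℂ h →ₗ[ℂ] ℂ, ∀ y, c (w.b y) = if y = x then 1 else 0 :=
  w.linInd_b.exists_linearMap_apply_eq _

/-- A linear functional that reads the coefficient of `b x`. -/
noncomputable def coord (w : SuperRootDatum X h) (x : X) : Module.Dual ℂ h →ₗ[ℂ] ℂ :=
  (w.exists_coord x).choose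

theorem coord_b_self (w : SuperRootDatum X h) (x : X) : w.coord x (w.b x) = 1 :=
  ((w.exists_coord x).choose_spec x).trans (if_pos rfl)

theorem coord_b_ne (w : SuperRootDatum X h) {x y : X} (hxy : y ≠ x) :
    w.coord x (w.b y) = 0 :=
  ((w.exists_coord x).choose_spec y).trans (if_neg hxy)

theorem Pos.exists_coord_eq {w : SuperRootDatum X h} {α : Module.Dual ℂ h} (hα : w.Pos α)
    (x : X) : ∃ n : ℕ, w.coord x α = n := by
  induction hα using AddSubmonoid.closure_induction with
  | mem _ hy =>
    obtain ⟨y, rfl⟩ := hy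
    by_cases hxy : y = x
    · subst hxy; exact ⟨1, by simp [coord_b_self]⟩
    · exact ⟨0, by simp [w.coord_b_ne hxy]⟩
  | zero => exact ⟨0, by simp⟩
  | add _ _ _ _ h1 h2 =>
    obtain ⟨m, hm⟩ := h1
    obtain ⟨n, hn⟩ := h2
    exact ⟨m + n, by rw [map_add, hm, hn]; push_cast; rfl⟩

/-- A vector in the span of the simple roots with vanishing coefficients is zero. -/
theorem eq_zero_of_coord {w : SuperRootDatum X h} {α : Module.Dual ℂ h}
    (hα : α ∈ Submodule.span ℂ (Set.range w.b)) (h0 : ∀ x, w.coord x α = 0) : α = 0 := by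
  classical
  obtain ⟨c, rfl⟩ := (Finsupp.mem_span_range_iff_exists_finsupp).1 hα
  have : c = 0 := by
    ext x
    have h1 := h0 x
    rw [Finsupp.sum, map_sum, Finset.sum_eq_single x] at h1
    · simpa [coord_b_self] using h1
    · intro y _ hyx
      simp [w.coord_b_ne hyx]
    · intro hx
      simp [Finsupp.notMem_support_iff.1 hx]
  simp [this]

theorem Pos.mem_span {w : SuperRootDatum X h} {α : Module.Dual ℂ h} (hα : w.Pos α) :
    α ∈ Submodule.span ℂ (Set.range w.b) := by
  induction hα using AddSubmonoid.closure_induction with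
  | mem _ hy => exact Submodule.subset_span hy
  | zero => exact zero_mem _
  | add _ _ _ _ h1 h2 => exact Submodule.add_mem _ h1 h2

theorem Pos.eq_zero {w : SuperRootDatum X h} {α : Module.Dual ℂ h} (hα : w.Pos α)
    (hα' : w.Pos (-α)) : α = 0 := by
  refine eq_zero_of_coord hα.mem_span fun x => ?_
  obtain ⟨m, hm⟩ := hα.exists_coord_eq x
  obtain ⟨n, hn⟩ := hα'.exists_coord_eq x
  rw [map_neg, hm] at hn
  have : m + n = 0 := by exact_mod_cast (by linear_combination -hn : (m : ℂ) + n = 0)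
  rw [hm, show m = 0 by omega, Nat.cast_zero]

theorem Pos.of_list_sum (w : SuperRootDatum X h) (l : List X) : w.Pos (l.map w.b).sum := by
  induction l with
  | nil => exact zero_mem _
  | cons y l ih => simpa using (w.pos_b y).add ih

theorem list_sum_neg (w : SuperRootDatum X h) (l : List X) :
    (l.map fun x => -w.b x).sum = -(l.map w.b).sum := by
  induction l with
  | nil => simp
  | cons y l ih => simp [ih, add_comm]

namespace HalfBakedQuotient

variable {w w' : SuperRootDatum X h} (H : HalfBakedQuotient w) (H' : HalfBakedQuotient w')

/-- The nonzero weights of the adjoint action of `h`. -/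
def roots : Set (Module.Dual ℂ h) := {α | α ≠ 0 ∧ H.weightSpace α ≠ ⊥}

theorem e_ne_zero (x : X) : H.e x ≠ 0 := by
  intro h0
  have h1 := H.bracket_e_f_same x
  rw [h0, map_zero, LinearMap.zero_apply] at h1
  exact w.linInd_a.ne_zero x (H.ι_injective (by rw [← h1, map_zero]))

theorem b_mem_roots (x : X) : w.b x ∈ H.roots :=
  ⟨w.linInd_b.ne_zero x, fun h0 =>
    H.e_ne_zero x ((Submodule.mem_bot ℂ).1 (h0 ▸ H.e_mem_weightSpace x))⟩

theorem pos_or_neg {α : Module.Dual ℂ h} (hα : α ∈ H.roots) : w.Pos α ∨ w.Pos (-α) := by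
  obtain ⟨i, hi⟩ : ∃ i, monomialWeight w i = α := by
    by_contra! hne
    refine hα.2 (le_bot_iff.1 ((H.weightSpace_le_span_monomial α).trans ?_))
    have : {i | monomialWeight w i = α} = ∅ := Set.eq_empty_iff_forall_notMem.2 hne
    rw [this, Set.image_empty, Submodule.span_empty]
  rcases i with t | ⟨y, l⟩ | ⟨y, l⟩
  · exact absurd hi.symm hα.1
  · left
    rw [← hi]
    exact (w.pos_b y).add (Pos.of_list_sum w l)
  · right
    have h1 : -w.b y + (l.map fun x => -w.b x).sum = α := hi
    rw [← h1, list_sum_neg, neg_add, neg_neg, neg_neg]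
    exact (w.pos_b y).add (Pos.of_list_sum w l)

variable {H H'}

theorem map_mem_weightSpace (φ : LieSuperalgebra.Iso H.alg H'.alg) {θ : h ≃ₗ[ℂ] h}
    (hφ : ∀ t, φ.toEquiv (H.ι t) = H'.ι (θ t)) {α : Module.Dual ℂ h} {s : H.alg.carrier}
    (hs : s ∈ H.weightSpace α) :
    φ.toEquiv s ∈ H'.weightSpace (α.comp θ.symm.toLinearMap) := by
  intro t
  have h1 := hφ (θ.symm t)
  rw [LinearEquiv.apply_symm_apply] at h1
  rw [← h1, ← φ.map_bracket, hs, map_smul]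
  rfl

theorem map_mem_roots (φ : LieSuperalgebra.Iso H.alg H'.alg) {θ : h ≃ₗ[ℂ] h}
    (hφ : ∀ t, φ.toEquiv (H.ι t) = H'.ι (θ t)) {α : Module.Dual ℂ h} (hα : α ∈ H.roots) :
    α.comp θ.symm.toLinearMap ∈ H'.roots := by
  obtain ⟨s, hs, hs0⟩ := Submodule.exists_mem_ne_zero_of_ne_bot hα.2
  refine ⟨fun h0 => hα.1 (LinearMap.ext fun t => ?_), fun h0 => hs0 ?_⟩
  · simpa using LinearMap.congr_fun h0 (θ t)
  · have := map_mem_weightSpace φ hφ hs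
    rw [h0, Submodule.mem_bot] at this
    simpa using this

/-- A simple root determines its coroot up to a scalar, and its parity. -/
theorem exists_a_eq_smul (φ : LieSuperalgebra.Iso H.alg H'.alg)
    (hφ : ∀ t, φ.toEquiv (H.ι t) = H'.ι t) {x x' : X} (hb : w.b x = w'.b x') :
    (∃ c : ℂ, w.a x = c • w'.a x') ∧ w.p x = w'.p x' := by
  have hφ' : ∀ t, φ.toEquiv (H.ι t) = H'.ι (LinearEquiv.refl ℂ h t) := hφ
  have he := map_mem_weightSpace φ hφ' (H.e_mem_weightSpace x)
  have hf := map_mem_weightSpace φ hφ' (H.f_mem_weightSpace x)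
  have hcomp : ∀ α : Module.Dual ℂ h,
      α.comp (LinearEquiv.refl ℂ h).symm.toLinearMap = α := fun α => rfl
  rw [hcomp, hb] at he hf
  obtain ⟨c, hc⟩ := Submodule.mem_span_singleton.1 (H'.weightSpace_b_le x' he)
  obtain ⟨d, hd⟩ := Submodule.mem_span_singleton.1 (H'.weightSpace_neg_b_le x' hf)
  refine ⟨⟨c * d, H'.ι_injective ?_⟩, ?_⟩
  · rw [← hφ, ← H.bracket_e_f_same, φ.map_bracket, ← hc, ← hd, map_smul, map_smul, map_smul,
      LinearMap.smul_apply, H'.bracket_e_f_same, smul_smul, mul_comm]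
  · by_contra hp
    have hdis := (DirectSum.IsInternal.submodule_iSupIndep H'.alg.isInternal).pairwiseDisjoint hp
    have h1 : φ.toEquiv (H.e x) ∈ H'.alg.grade (w.p x) := φ.map_grade _ _ (H.e_mem x)
    have h2 : φ.toEquiv (H.e x) ∈ H'.alg.grade (w'.p x') := by
      rw [← hc]; exact Submodule.smul_mem _ _ (H'.e_mem x')
    exact H.e_ne_zero x (by simpa using Submodule.disjoint_def.1 hdis _ h1 h2)

end HalfBakedQuotient

/-- A class of root data on the same space, closed under reflexions, whose simple roots are the
simple roots of a common set `Δ` of nonzero weights, as in the connected component of an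
admissible root datum. -/
structure CommonRoots [DecidableEq X] (C : Set (SuperRootDatum X h)) (Δ : Set (Module.Dual ℂ h)) : Prop where
  reflexion_mem : ∀ {w x}, w ∈ C → w.Reflectable x → w.reflexion x ∈ C
  b_mem : ∀ {w}, w ∈ C → ∀ x, w.b x ∈ Δ
  ne_zero : ∀ {α}, α ∈ Δ → α ≠ 0
  pos_or_neg : ∀ {w α}, w ∈ C → α ∈ Δ → w.Pos α ∨ w.Pos (-α)
  a_eq : ∀ {w w' x x'}, w ∈ C → w' ∈ C → w.b x = w'.b x' → ∃ c : ℂ, w.a x = c • w'.a x'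
  p_eq : ∀ {w w' x x'}, w ∈ C → w' ∈ C → w.b x = w'.b x' → w.p x = w'.p x'
  sub_mem : ∀ {w x α}, w ∈ C → w.Reflectable x → w.Anisotropic x → α ∈ Δ →
    α - (2 * α (w.a x) / w.cartan x x) • w.b x ∈ Δ

theorem smul_b_apply_a {w : SuperRootDatum X h} {x : X} (hx : w.Anisotropic x) :
    ((2 / w.cartan x x) • w.b x) (w.a x) = 2 := by
  rw [LinearMap.smul_apply, smul_eq_mul]
  exact div_mul_cancel₀ _ hx

/-- The linear reflection of `h` that induces an anisotropic reflexion. -/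
noncomputable def linearReflection (w : SuperRootDatum X h) (x : X) (hx : w.Anisotropic x) :
    h ≃ₗ[ℂ] h := Module.reflection (smul_b_apply_a hx)

theorem linearReflection_apply {w : SuperRootDatum X h} {x : X} (hx : w.Anisotropic x) (t : h) :
    w.linearReflection x hx t = t - (2 * w.b x t / w.cartan x x) • w.a x := by
  rw [linearReflection, Module.reflection_apply, LinearMap.smul_apply, smul_eq_mul,
    div_mul_eq_mul_div]

theorem linearReflection_symm {w : SuperRootDatum X h} {x : X} (hx : w.Anisotropic x) :
    (w.linearReflection x hx).symm = w.linearReflection x hx :=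
  Module.reflection_symm _

theorem comp_linearReflection {w : SuperRootDatum X h} {x : X} (hx : w.Anisotropic x)
    (α : Module.Dual ℂ h) : α.comp (w.linearReflection x hx).symm.toLinearMap =
      α - (2 * α (w.a x) / w.cartan x x) • w.b x := by
  ext t
  rw [linearReflection_symm]
  simp only [LinearMap.comp_apply, LinearEquiv.coe_coe, linearReflection_apply, map_sub, map_smul,
    LinearMap.sub_apply, LinearMap.smul_apply, smul_eq_mul]
  ring

variable [DecidableEq X]

theorem reflexion_eq_transport {w : SuperRootDatum X h} {x : X} (hx : w.Anisotropic x) :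
    w.reflexion x = w.transport (w.linearReflection x hx) := by
  have hx' : w.cartan x x ≠ 0 := hx
  ext1
  · funext y
    change w.reflA x y = w.linearReflection x hx (w.a y)
    rw [linearReflection_apply, reflA, if_pos hx']
    rfl
  · funext y
    change w.reflB x y = (w.b y).comp (w.linearReflection x hx).symm.toLinearMap
    rw [comp_linearReflection, reflB, if_pos hx']
    rfl
  · funext y
    change w.reflP x y = w.p y
    rw [reflP, if_pos hx']

/-- The root data joined to `v` by arrows, in both directions, that induce the identity of `h`. -/
def idComponent (v : SuperRootDatum X h) : Set (SuperRootDatum X h) :=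
  {w | IsArrow v w (LinearEquiv.refl ℂ h) ∧ IsArrow w v (LinearEquiv.refl ℂ h)}

theorem self_mem_idComponent (v : SuperRootDatum X h) : v ∈ v.idComponent :=
  ⟨IsArrow.id v, IsArrow.id v⟩

theorem reflexion_mem_idComponent {v w : SuperRootDatum X h} {x : X} (hw : w ∈ v.idComponent)
    (hx : w.Reflectable x) : w.reflexion x ∈ v.idComponent := by
  refine ⟨IsArrow.comp hw.1 (IsArrow.reflexion w x hx), ?_⟩
  have h1 := IsArrow.reflexion _ _ hx.reflexion
  rw [reflexion_reflexion] at h1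
  exact IsArrow.comp h1 hw.2

theorem Admissible.exists_commonRoots {v : SuperRootDatum X h} (hv : v.Admissible) :
    ∃ Δ, CommonRoots v.idComponent Δ := by
  obtain ⟨g, hg⟩ := hv
  let G : ∀ w : v.idComponent, HalfBakedQuotient w.1 := fun w => g w.1 ⟨⟨_, w.2.1⟩⟩
  have hG : ∀ (w w' : v.idComponent) (θ : h ≃ₗ[ℂ] h), IsArrow w.1 w'.1 θ →
      ∃ φ : LieSuperalgebra.Iso (G w).alg (G w').alg,
        ∀ t, φ.toEquiv ((G w).ι t) = (G w').ι (θ t) :=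
    fun w w' θ hθ => hg w.1 w'.1 _ _ ⟨θ, hθ⟩
  have hid : ∀ w w' : v.idComponent, IsArrow w.1 w'.1 (LinearEquiv.refl ℂ h) :=
    fun w w' => IsArrow.comp w.2.2 w'.2.1
  have hroots : ∀ (w w' : v.idComponent), (G w).roots ⊆ (G w').roots := by
    intro w w' α hα
    obtain ⟨φ, hφ⟩ := hG w w' _ (hid w w')
    exact HalfBakedQuotient.map_mem_roots φ hφ hα
  let v' : v.idComponent := ⟨v, v.self_mem_idComponent⟩
  refine ⟨(G v').roots, ⟨fun hw hx => reflexion_mem_idComponent hw hx, ?_, fun hα => hα.1, ?_, ?_,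
    ?_, ?_⟩⟩
  · exact fun {w} hw x => hroots ⟨w, hw⟩ v' ((G ⟨w, hw⟩).b_mem_roots x)
  · exact fun {w α} hw hα => (G ⟨w, hw⟩).pos_or_neg (hroots v' ⟨w, hw⟩ hα)
  · intro w w' x x' hw hw' hb
    obtain ⟨φ, hφ⟩ := hG ⟨w, hw⟩ ⟨w', hw'⟩ _ (hid _ _)
    exact (HalfBakedQuotient.exists_a_eq_smul φ hφ hb).1
  · intro w w' x x' hw hw' hb
    obtain ⟨φ, hφ⟩ := hG ⟨w, hw⟩ ⟨w', hw'⟩ _ (hid _ _)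
    exact (HalfBakedQuotient.exists_a_eq_smul φ hφ hb).2
  · intro w x α hw hx hx' hα
    -- The arrow from `w` to its reflexion is taken tautologically here, so that it induces the
    -- linear reflection instead of the identity; comparing the two makes `Δ` stable under the
    -- reflection.
    have h1 := IsArrow.tautological w (w.linearReflection x hx')
    rw [← reflexion_eq_transport] at h1
    obtain ⟨φ, hφ⟩ := hG ⟨w, hw⟩ ⟨w.reflexion x, reflexion_mem_idComponent hw hx⟩ _ h1
    rw [← comp_linearReflection hx']
    exact hroots _ _ (HalfBakedQuotient.map_mem_roots φ hφ (hroots v' ⟨w, hw⟩ hα))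

end SuperRootDatum

/-! ### Signs of simple roots, and reflectability as a property of the root. -/

namespace SuperRootDatum

variable {X : Type v} {h : Type u} [AddCommGroup h] [Module ℂ h]

/-- The simple roots of the members of `C`. -/
def simpleRoots (C : Set (SuperRootDatum X h)) : Set (Module.Dual ℂ h) :=
  {α | ∃ w ∈ C, ∃ x, w.b x = α}

/-- The simple roots of the members of `C` at which there is a reflexion. -/
def reflectableRoots (C : Set (SuperRootDatum X h)) : Set (Module.Dual ℂ h) :=
  {α | ∃ w ∈ C, ∃ x, w.Reflectable x ∧ w.b x = α}

theorem reflectableRoots_subset (C : Set (SuperRootDatum X h)) :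
    reflectableRoots C ⊆ simpleRoots C := by
  rintro _ ⟨w, hw, x, _, rfl⟩
  exact ⟨w, hw, x, rfl⟩

variable [DecidableEq X]

theorem exists_reflexion_b_eq (w : SuperRootDatum X h) (x y : X) :
    ∃ c : ℂ, (w.reflexion x).b y = w.b y + c • w.b x := by
  by_cases hyx : y = x
  · exact ⟨-2, by rw [hyx, reflexion_b_self]; module⟩
  by_cases h0 : w.cartan x x = 0
  · by_cases hxy : w.cartan x y = 0
    · exact ⟨0, by rw [reflexion_b_of_isotropic_of_eq h0 hyx hxy]; module⟩
    · exact ⟨1, by rw [reflexion_b_of_isotropic_of_ne h0 hyx hxy]; module⟩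
  · exact ⟨-(2 * w.cartan x y / w.cartan x x), by
      rw [reflexion_b_of_anisotropic h0]; module⟩

theorem exists_reflexion_a_eq (w : SuperRootDatum X h) (x y : X) :
    ∃ c : ℂ, (w.reflexion x).a y = w.a y + c • w.a x := by
  by_cases hyx : y = x
  · exact ⟨-2, by rw [hyx, reflexion_a_self]; module⟩
  by_cases h0 : w.cartan x x = 0
  · by_cases hxy : w.cartan x y = 0
    · exact ⟨0, by rw [reflexion_a_of_isotropic_of_eq h0 hyx hxy]; module⟩
    · exact ⟨_, reflexion_a_of_isotropic_of_ne h0 hyx hxy⟩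
  · exact ⟨-(2 * w.cartan y x / w.cartan x x), by
      rw [reflexion_a_of_anisotropic h0]; module⟩

/-- A reflexion at `x` alters each simple root by a multiple of `b x`, so the other coefficients are
insensitive to it. -/
theorem coord_reflexion (w : SuperRootDatum X h) {x y : X} (hyx : y ≠ x) {α : Module.Dual ℂ h}
    (hα : α ∈ Submodule.span ℂ (Set.range w.b)) :
    (w.reflexion x).coord y α = w.coord y α := by
  have hx : w.b x = -(w.reflexion x).b x := by rw [reflexion_b_self, neg_neg]
  induction hα using Submodule.span_induction with
  | mem _ hz =>
    obtain ⟨z, rfl⟩ := hz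
    obtain ⟨c, hc⟩ := w.exists_reflexion_b_eq x z
    have hz : w.b z = (w.reflexion x).b z + c • (w.reflexion x).b x := by
      rw [hc, reflexion_b_self]; module
    have h1 : (w.reflexion x).coord y (w.b z) = (w.reflexion x).coord y ((w.reflexion x).b z) := by
      rw [hz, map_add, map_smul, coord_b_ne _ hyx.symm, smul_zero, add_zero]
    rw [h1]
    by_cases hzy : z = y
    · rw [hzy, coord_b_self, coord_b_self]
    · rw [coord_b_ne _ hzy, coord_b_ne _ hzy]
  | zero => simp
  | add _ _ _ _ h1 h2 => rw [map_add, map_add, h1, h2]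
  | smul c _ _ h1 => rw [map_smul, map_smul, h1]

theorem pos_reflexion_neg_b (w : SuperRootDatum X h) (x : X) : (w.reflexion x).Pos (-w.b x) := by
  rw [← reflexion_b_self]
  exact pos_b _ x

namespace CommonRoots

variable {C : Set (SuperRootDatum X h)} {Δ : Set (Module.Dual ℂ h)} (hC : CommonRoots C Δ)
  {w u : SuperRootDatum X h} {x y : X} {α : Module.Dual ℂ h}

include hC

theorem simpleRoots_subset : simpleRoots C ⊆ Δ := by
  rintro _ ⟨w, hw, x, rfl⟩
  exact hC.b_mem hw x

theorem neg_mem_reflectableRoots (hα : α ∈ reflectableRoots C) : -α ∈ reflectableRoots C := by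
  obtain ⟨w, hw, x, hx, rfl⟩ := hα
  exact ⟨_, hC.reflexion_mem hw hx, x, hx.reflexion, w.reflexion_b_self x⟩

theorem pos_neg_iff (hw : w ∈ C) (hα : α ∈ Δ) : w.Pos (-α) ↔ ¬ w.Pos α :=
  ⟨fun h1 h2 => hC.ne_zero hα (h2.eq_zero h1), fun h1 => (hC.pos_or_neg hw hα).resolve_left h1⟩

theorem not_pos_reflexion (hw : w ∈ C) (hx : w.Reflectable x) :
    ¬ (w.reflexion x).Pos (w.b x) :=
  (hC.pos_neg_iff (hC.reflexion_mem hw hx) (hC.b_mem hw x)).1 (w.pos_reflexion_neg_b x)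

/-- A simple root that is a multiple of the simple root `b x` of `w`, and positive, is `b x`. -/
theorem eq_b_of_coord (hw : w ∈ C) (hα : α ∈ simpleRoots C) (hpos : w.Pos α)
    (h0 : ∀ y, y ≠ x → w.coord y α = 0) : α = w.b x := by
  obtain ⟨n, hn⟩ := hpos.exists_coord_eq x
  have h1 : α = (n : ℂ) • w.b x := by
    rw [← sub_eq_zero]
    refine eq_zero_of_coord (w := w) (Submodule.sub_mem _ hpos.mem_span
      (Submodule.smul_mem _ _ (w.pos_b x).mem_span)) fun y => ?_
    rw [map_sub, map_smul]
    by_cases hyx : y = x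
    · rw [hyx, hn, coord_b_self]; simp
    · rw [h0 y hyx, coord_b_ne w (Ne.symm hyx)]; simp
  -- Reading the coefficient at `x'` in the basis of `w'`, where `α` is simple, gives one as `n`
  -- times an integer. This needs `α` simple somewhere: `Δ` may contain proper multiples of `b x`.
  obtain ⟨w', hw', x', rfl⟩ := hα
  have h2 := congrArg (w'.coord x') h1
  rw [coord_b_self, map_smul, smul_eq_mul] at h2
  rcases hC.pos_or_neg hw' (hC.b_mem hw x) with h3 | h3
  · obtain ⟨m, hm⟩ := h3.exists_coord_eq x'
    rw [hm] at h2
    have h4 : n * m = 1 := by exact_mod_cast h2.symm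
    rw [h1, Nat.eq_one_of_mul_eq_one_right h4, Nat.cast_one, one_smul]
  · obtain ⟨m, hm⟩ := h3.exists_coord_eq x'
    rw [map_neg] at hm
    have h4 : ((n * m + 1 : ℕ) : ℂ) = 0 := by
      push_cast; rw [← hm]; linear_combination h2
    exact absurd (Nat.cast_eq_zero.1 h4) (by omega)

/-- A reflexion at `x` changes the sign of no other simple root than `b x`. -/
theorem pos_reflexion (hw : w ∈ C) (hx : w.Reflectable x) (hα : α ∈ simpleRoots C)
    (hne : α ≠ w.b x) (hpos : w.Pos α) : (w.reflexion x).Pos α := by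
  by_contra hneg
  have hneg' := (hC.pos_neg_iff (hC.reflexion_mem hw hx) (hC.simpleRoots_subset hα)).2 hneg
  -- The coefficients away from `x` are unchanged, hence both nonnegative and nonpositive.
  refine hne (hC.eq_b_of_coord hw hα hpos fun y hy => ?_)
  obtain ⟨m, hm⟩ := hpos.exists_coord_eq y
  obtain ⟨n, hn⟩ := hneg'.exists_coord_eq y
  rw [map_neg, w.coord_reflexion hy hpos.mem_span, hm] at hn
  have : m + n = 0 := by exact_mod_cast (by linear_combination -hn : (m : ℂ) + n = 0)
  rw [hm, show m = 0 by omega, Nat.cast_zero]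

theorem pos_of_pos_reflexion (hw : w ∈ C) (hx : w.Reflectable x) (hα : α ∈ simpleRoots C)
    (hne : α ≠ -w.b x) (hpos : (w.reflexion x).Pos α) : w.Pos α := by
  have h1 := hC.pos_reflexion (hC.reflexion_mem hw hx) hx.reflexion hα
    (by rwa [reflexion_b_self]) hpos
  rwa [reflexion_reflexion] at h1

/-- A simple root shared by two members of `C` is reflectable at both or at neither. -/
theorem reflectable_of_mem (hw : w ∈ C) (hx : w.b x ∈ reflectableRoots C) : w.Reflectable x := by
  obtain ⟨w', hw', x', hx', hb⟩ := hx
  obtain ⟨c, hc⟩ := hC.a_eq hw hw' hb.symm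
  have hp := hC.p_eq hw hw' hb.symm
  have hc0 : c ≠ 0 := by
    rintro rfl
    exact w.linInd_a.ne_zero x (by rw [hc, zero_smul])
  have hcar : w.cartan x x = c * w'.cartan x' x' := by
    rw [cartan, cartan, hc, hb, map_smul, smul_eq_mul]
  by_cases h0 : w'.cartan x' x' = 0
  · have h1 : w.cartan x x = 0 := by rw [hcar, h0, mul_zero]
    exact ⟨fun _ => by rw [hp, hx'.1 h0], fun h2 => absurd h1 h2, fun h2 => absurd h1 h2⟩
  have h1 : w.cartan x x ≠ 0 := by rw [hcar]; exact mul_ne_zero hc0 h0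
  have hco : ∀ β : Module.Dual ℂ h,
      2 * β (w'.a x') / w'.cartan x' x' = 2 * β (w.a x) / w.cartan x x := by
    intro β
    rw [hcar, hc, map_smul, smul_eq_mul]
    field_simp
  -- The reflected root `b y - c • b x` lies in `Δ` and has coefficient one at `y`; it is therefore
  -- positive, and `-c` is a natural number.
  have hint : ∀ y, y ≠ x → ∃ n : ℕ, 2 * w.cartan x y / w.cartan x x = -(n : ℂ) := by
    intro y hyx
    have h2 := hC.sub_mem hw' hx' h0 (hC.b_mem hw y)
    rw [hco, hb] at h2
    change w.b y - (2 * w.cartan x y / w.cartan x x) • w.b x ∈ Δ at h2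
    have hy1 : w.coord y (w.b y - (2 * w.cartan x y / w.cartan x x) • w.b x) = 1 := by
      rw [map_sub, map_smul, coord_b_self, coord_b_ne w (Ne.symm hyx), smul_zero, sub_zero]
    have hx1 : w.coord x (w.b y - (2 * w.cartan x y / w.cartan x x) • w.b x) =
        -(2 * w.cartan x y / w.cartan x x) := by
      rw [map_sub, map_smul, coord_b_self, coord_b_ne w hyx, smul_eq_mul, mul_one, zero_sub]
    rcases hC.pos_or_neg hw h2 with h3 | h3
    · obtain ⟨n, hn⟩ := h3.exists_coord_eq x
      exact ⟨n, by rw [← hn, hx1, neg_neg]⟩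
    · obtain ⟨n, hn⟩ := h3.exists_coord_eq y
      rw [map_neg, hy1] at hn
      have h4 : ((n + 1 : ℕ) : ℂ) = 0 := by push_cast; linear_combination -hn
      exact absurd (Nat.cast_eq_zero.1 h4) (by omega)
  refine ⟨fun h2 => absurd h2 h1, fun _ _ => hint, fun _ hp1 y hyx => ?_⟩
  obtain ⟨n, hn⟩ := hint y hyx
  -- For an odd root the integer must be even. Reflectability at `w'` gives this on the simple roots
  -- of `w'`, hence on `b y`, which is positive or negative there.
  have heven : ∀ β : Module.Dual ℂ h, w'.Pos β →
      ∃ k : ℤ, 2 * β (w'.a x') / w'.cartan x' x' = 2 * k := by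
    intro β hβ
    induction hβ using AddSubmonoid.closure_induction with
    | mem _ hz =>
      obtain ⟨z, rfl⟩ := hz
      by_cases hzx : z = x'
      · subst hzx
        refine ⟨1, ?_⟩
        change 2 * w'.cartan z z / w'.cartan z z = _
        rw [mul_div_assoc, div_self h0]; simp
      · obtain ⟨k, hk⟩ := hx'.2.2 h0 (hp ▸ hp1) z hzx
        refine ⟨-k, ?_⟩
        change 2 * w'.cartan x' z / w'.cartan x' x' = _
        rw [mul_div_assoc, hk]; push_cast; rfl
    | zero => exact ⟨0, by simp⟩
    | add β₁ β₂ _ _ h1 h2 =>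
      obtain ⟨k₁, hk₁⟩ := h1
      obtain ⟨k₂, hk₂⟩ := h2
      refine ⟨k₁ + k₂, ?_⟩
      rw [LinearMap.add_apply, mul_add, add_div, hk₁, hk₂]; push_cast; ring
  obtain ⟨k, hk⟩ : ∃ k : ℤ, 2 * w.cartan x y / w.cartan x x = 2 * k := by
    rcases hC.pos_or_neg hw' (hC.b_mem hw y) with h3 | h3
    · obtain ⟨k, hk⟩ := heven _ h3
      rw [hco] at hk
      exact ⟨k, hk⟩
    · obtain ⟨k, hk⟩ := heven _ h3
      rw [hco] at hk
      refine ⟨-k, ?_⟩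
      change 2 * w.b y (w.a x) / w.cartan x x = _
      rw [LinearMap.neg_apply, mul_neg, neg_div] at hk
      push_cast
      linear_combination -hk
  have hkn : (2 * k : ℤ) = -n := by
    have : (2 * k : ℂ) = -n := hk.symm.trans hn
    exact_mod_cast this
  refine ⟨k.natAbs, ?_⟩
  have hk2 : (k.natAbs : ℤ) = -k := by omega
  have hk3 : ((k.natAbs : ℕ) : ℂ) = -k := by
    rw [← Int.cast_natCast, hk2]; push_cast; rfl
  rw [hk3, neg_neg]
  rw [mul_div_assoc] at hk
  exact mul_left_cancel₀ two_ne_zero hk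

/-- `a_{xy}` and `a_{yx}` vanish together when `x` and `y` are reflectable. -/
theorem cartan_eq_zero (hw : w ∈ C) (hx : w.Reflectable x) (hy : w.Reflectable y) (hxy : x ≠ y)
    (h0 : w.cartan x y = 0) : w.cartan y x = 0 := by
  by_contra hne
  have hb : (w.reflexion x).b y = w.b y := by
    by_cases hxx : w.cartan x x = 0
    · exact reflexion_b_of_isotropic_of_eq hxx hxy.symm h0
    · rw [reflexion_b_of_anisotropic hxx, h0]; simp
  obtain ⟨n, hn0, hn⟩ : ∃ n : ℕ, n ≠ 0 ∧ (w.reflexion y).b x = w.b x + (n : ℂ) • w.b y := by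
    by_cases hyy : w.cartan y y = 0
    · exact ⟨1, one_ne_zero, by rw [reflexion_b_of_isotropic_of_ne hyy hxy hne]; simp⟩
    · obtain ⟨n, hn⟩ : ∃ n : ℕ, 2 * w.cartan y x / w.cartan y y = -(n : ℂ) := by
        by_cases hp : w.p y = 0
        · exact hy.2.1 hyy hp x hxy
        · have hp1 : w.p y = 1 := by
            generalize w.p y = p at hp
            revert hp; revert p; decide
          obtain ⟨n, hn⟩ := hy.2.2 hyy hp1 x hxy
          exact ⟨2 * n, by rw [mul_div_assoc, hn]; push_cast; ring⟩
      refine ⟨n, ?_, by rw [reflexion_b_of_anisotropic hyy, hn]; module⟩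
      rintro rfl
      rw [Nat.cast_zero, neg_zero, div_eq_zero_iff] at hn
      rcases hn with hn | hn
      · exact hne (by simpa using hn)
      · exact hyy hn
  -- The root `b x + n • b y`, simple after the reflexion at `y`, has coefficients `-1` and `n > 0`
  -- in the simple roots obtained by reflecting at `x`: it is neither positive nor negative.
  have hmem := hC.b_mem (hC.reflexion_mem hw hy) x
  have hform : (w.reflexion y).b x =
      -(w.reflexion x).b x + (n : ℂ) • (w.reflexion x).b y := by
    rw [hn, hb, reflexion_b_self, neg_neg]
  have hcx : (w.reflexion x).coord x ((w.reflexion y).b x) = -1 := by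
    rw [hform, map_add, map_neg, map_smul, coord_b_self, coord_b_ne _ hxy.symm]; simp
  have hcy : (w.reflexion x).coord y ((w.reflexion y).b x) = n := by
    rw [hform, map_add, map_neg, map_smul, coord_b_self, coord_b_ne _ hxy]; simp
  rcases hC.pos_or_neg (hC.reflexion_mem hw hx) hmem with h3 | h3
  · obtain ⟨m, hm⟩ := h3.exists_coord_eq x
    rw [hcx] at hm
    have h4 : ((m + 1 : ℕ) : ℂ) = 0 := by push_cast; linear_combination -hm
    exact absurd (Nat.cast_eq_zero.1 h4) (by omega)
  · obtain ⟨m, hm⟩ := h3.exists_coord_eq y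
    rw [map_neg, hcy] at hm
    have h4 : ((m + n : ℕ) : ℂ) = 0 := by push_cast; linear_combination -hm
    exact absurd (Nat.cast_eq_zero.1 h4) (by omega)

end CommonRoots

end SuperRootDatum

/-! ### Walks, and the number of roots separating two vertices. -/

namespace SuperRootDatum

variable {X : Type v} {h : Type u} [AddCommGroup h] [Module ℂ h]

/-- The reflectable roots that are positive for `w` and not for `u`. -/
def inversions (C : Set (SuperRootDatum X h)) (w u : SuperRootDatum X h) :
    Set (Module.Dual ℂ h) :=
  {α | α ∈ reflectableRoots C ∧ w.Pos α ∧ ¬ u.Pos α}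

/-- The number of reflectable roots that separate `w` from `u`. -/
noncomputable def separation (C : Set (SuperRootDatum X h)) (w u : SuperRootDatum X h) : ℕ :=
  (inversions C w u).ncard

theorem inversions_self (C : Set (SuperRootDatum X h)) (w : SuperRootDatum X h) :
    inversions C w w = ∅ :=
  Set.eq_empty_iff_forall_notMem.2 fun _ hα => hα.2.2 hα.2.1

theorem separation_self (C : Set (SuperRootDatum X h)) (w : SuperRootDatum X h) :
    separation C w w = 0 := by
  rw [separation, inversions_self, Set.ncard_empty]

variable [DecidableEq X]

/-- `Walk S n w u`: there is a path of `n` reflexions from `w` to `u`, with labels in `S`. -/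
inductive Walk (S : Set X) : ℕ → SuperRootDatum X h → SuperRootDatum X h → Prop
  | nil (w : SuperRootDatum X h) : Walk S 0 w w
  | cons {n : ℕ} {w u : SuperRootDatum X h} {x : X} : x ∈ S → w.Reflectable x →
      Walk S n (w.reflexion x) u → Walk S (n + 1) w u

namespace Walk

variable {S T : Set X} {m n : ℕ} {w u t : SuperRootDatum X h} {x : X}

theorem mono (hST : S ⊆ T) (hw : Walk S n w u) : Walk T n w u := by
  induction hw with
  | nil w => exact nil w
  | cons hx hr _ ih => exact cons (hST hx) hr ih

theorem trans (h1 : Walk S m w u) (h2 : Walk S n u t) : Walk S (m + n) w t := by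
  induction h1 with
  | nil w => simpa using h2
  | cons hx hr _ ih =>
    rw [Nat.add_right_comm]
    exact cons hx hr (ih h2)

theorem single (hx : x ∈ S) (hr : w.Reflectable x) : Walk S 1 w (w.reflexion x) :=
  cons hx hr (nil _)

theorem snoc (h1 : Walk S n w u) (hx : x ∈ S) (hr : u.Reflectable x) :
    Walk S (n + 1) w (u.reflexion x) := h1.trans (single hx hr)

theorem symm (h1 : Walk S n w u) : Walk S n u w := by
  induction h1 with
  | nil w => exact nil w
  | @cons _ w _ x hx hr _ ih =>
    have := ih.snoc hx hr.reflexion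
    rwa [reflexion_reflexion] at this

theorem exists_last (h1 : Walk S (n + 1) w u) :
    ∃ t x, x ∈ S ∧ t.Reflectable x ∧ Walk S n w t ∧ t.reflexion x = u := by
  cases h1.symm with
  | @cons _ _ _ x hx hr h2 =>
    exact ⟨u.reflexion x, x, hx, hr.reflexion, h2.symm, u.reflexion_reflexion x⟩

theorem mem {C : Set (SuperRootDatum X h)} {Δ : Set (Module.Dual ℂ h)} (hC : CommonRoots C Δ)
    (h1 : Walk S n w u) (hw : w ∈ C) : u ∈ C := by
  induction h1 with
  | nil w => exact hw
  | cons _ hr _ ih => exact ih (hC.reflexion_mem hw hr)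

theorem of_isPath (w : SuperRootDatum X h) (l : List X) (hl : w.IsPath l) :
    Walk Set.univ l.length w (w.pathEnd l) := by
  induction l generalizing w with
  | nil => exact nil w
  | cons x l ih => exact cons trivial hl.1 (ih _ hl.2)

theorem exists_isPath (h1 : Walk S n w u) :
    ∃ l : List X, w.IsPath l ∧ w.pathEnd l = u ∧ l.length = n := by
  induction h1 with
  | nil w => exact ⟨[], trivial, rfl, rfl⟩
  | @cons _ w _ x _ hr _ ih =>
    obtain ⟨l, h1, h2, h3⟩ := ih
    exact ⟨x :: l, ⟨hr, h1⟩, h2, by simp [h3]⟩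

end Walk

namespace CommonRoots

variable {C : Set (SuperRootDatum X h)} {Δ : Set (Module.Dual ℂ h)} (hC : CommonRoots C Δ)
  {w u t : SuperRootDatum X h} {x y : X} {α : Module.Dual ℂ h} {S : Set X} {n : ℕ}

include hC

/-- A simple root that changes sign along a walk is crossed by it. -/
theorem exists_crossing (hw : w ∈ C) (h1 : Walk S n w u) (hα : α ∈ simpleRoots C)
    (hpos : w.Pos α) (hneg : ¬ u.Pos α) :
    ∃ t ∈ C, ∃ x ∈ S, t.Reflectable x ∧ t.b x = α ∧ ∃ m, Walk S m w t := by
  induction h1 with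
  | nil w => exact absurd hpos hneg
  | @cons _ w _ x hx hr _ ih =>
    by_cases hαx : α = w.b x
    · exact ⟨w, hw, x, hx, hr, hαx.symm, 0, Walk.nil w⟩
    · obtain ⟨t, ht, y, hy, hry, hb, m, hm⟩ :=
        ih (hC.reflexion_mem hw hr) (hC.pos_reflexion hw hr hα hαx hpos) hneg
      exact ⟨t, ht, y, hy, hry, hb, m + 1, Walk.cons hx hr hm⟩

theorem mem_reflectableRoots_of_walk (hw : w ∈ C) (h1 : Walk S n w u) (hα : α ∈ simpleRoots C)
    (hpos : w.Pos α) (hneg : ¬ u.Pos α) : α ∈ reflectableRoots C := by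
  obtain ⟨t, ht, x, _, hx, hb, _⟩ := hC.exists_crossing hw h1 hα hpos hneg
  exact ⟨t, ht, x, hx, hb⟩

/-- Only `u.b x` and its negative change sign between `u` and its reflexion, and the negative is
excluded because `u.b x` is positive for `w`. -/
theorem inversions_reflexion (hu : u ∈ C) (hx : u.Reflectable x)
    (hpos : w.Pos (u.b x)) :
    inversions C w (u.reflexion x) = insert (u.b x) (inversions C w u) := by
  ext α
  constructor
  · rintro ⟨hα, h1, h2⟩
    by_cases hαx : α = u.b x
    · exact Or.inl hαx
    · exact Or.inr ⟨hα, h1, fun h3 =>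
        h2 (hC.pos_reflexion hu hx (reflectableRoots_subset C hα) hαx h3)⟩
  · rintro (rfl | ⟨hα, h1, h2⟩)
    · exact ⟨⟨u, hu, x, hx, rfl⟩, hpos, hC.not_pos_reflexion hu hx⟩
    · refine ⟨hα, h1, fun h3 => ?_⟩
      by_cases hαx : α = -u.b x
      · rw [hαx] at h1
        exact hC.ne_zero (hC.b_mem hu x) (hpos.eq_zero h1)
      · exact h2 (hC.pos_of_pos_reflexion hu hx (reflectableRoots_subset C hα) hαx h3)

theorem inversions_of_not_pos (hw : w ∈ C) (hu : u ∈ C) (hx : u.Reflectable x)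
    (hneg : ¬ w.Pos (u.b x)) :
    inversions C w u = insert (-u.b x) (inversions C w (u.reflexion x)) := by
  have h1 := hC.inversions_reflexion (hC.reflexion_mem hu hx) hx.reflexion
    (by rw [reflexion_b_self]; exact (hC.pos_neg_iff hw (hC.b_mem hu x)).2 hneg)
  rwa [reflexion_reflexion, reflexion_b_self] at h1

/-- Each step of the walk adds or removes one root. Finiteness has to be proved because `Set.ncard`
is zero on infinite sets. -/
theorem finite_inversions (hw : w ∈ C) (h1 : Walk S n w u) : (inversions C w u).Finite := by
  induction n generalizing u with
  | zero =>
    cases h1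
    rw [inversions_self]
    exact Set.finite_empty
  | succ n ih =>
    obtain ⟨t, x, _, hr, h2, rfl⟩ := h1.exists_last
    have ht := h2.mem hC hw
    by_cases hpos : w.Pos (t.b x)
    · rw [hC.inversions_reflexion ht hr hpos]
      exact (ih h2).insert _
    · have := ih h2
      rw [hC.inversions_of_not_pos hw ht hr hpos] at this
      exact this.subset (Set.subset_insert _ _)

theorem separation_reflexion (hw : w ∈ C) (h1 : Walk S n w u) (hx : u.Reflectable x)
    (hpos : w.Pos (u.b x)) : separation C w (u.reflexion x) = separation C w u + 1 := by
  have hu := h1.mem hC hw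
  rw [separation, hC.inversions_reflexion hu hx hpos, Set.ncard_insert_of_notMem _
    (hC.finite_inversions hw h1)]
  · rfl
  · exact fun h2 => h2.2.2 (u.pos_b x)

theorem separation_of_not_pos (hw : w ∈ C) (h1 : Walk S n w u) (hx : u.Reflectable x)
    (hneg : ¬ w.Pos (u.b x)) : separation C w u = separation C w (u.reflexion x) + 1 := by
  have hu := h1.mem hC hw
  have hfin := hC.finite_inversions hw h1
  rw [hC.inversions_of_not_pos hw hu hx hneg] at hfin
  rw [separation, hC.inversions_of_not_pos hw hu hx hneg, Set.ncard_insert_of_notMem _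
    (hfin.subset (Set.subset_insert _ _))]
  · rfl
  · exact fun h2 => h2.2.2 (u.pos_reflexion_neg_b x)

theorem separation_reflexion_le (hw : w ∈ C) (h1 : Walk S n w u) (hx : u.Reflectable x) :
    separation C w (u.reflexion x) ≤ separation C w u + 1 := by
  by_cases hpos : w.Pos (u.b x)
  · rw [hC.separation_reflexion hw h1 hx hpos]
  · rw [hC.separation_of_not_pos hw h1 hx hpos]; omega

/-- Negation exchanges the two sets of inversions: it preserves reflectable roots and reverses
signs. -/
theorem separation_comm (hw : w ∈ C) (hu : u ∈ C) : separation C w u = separation C u w := by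
  have key : ∀ {w u}, w ∈ C → u ∈ C → ∀ {α}, α ∈ inversions C w u → -α ∈ inversions C u w := by
    intro w u hw hu α hα
    have hΔ := hC.simpleRoots_subset (reflectableRoots_subset C hα.1)
    exact ⟨hC.neg_mem_reflectableRoots hα.1, (hC.pos_neg_iff hu hΔ).2 hα.2.2,
      fun h1 => (hC.pos_neg_iff hw hΔ).1 h1 hα.2.1⟩
  have himg : inversions C u w = (fun α => -α) '' inversions C w u := by
    ext α
    constructor
    · exact fun hα => ⟨-α, key hu hw hα, neg_neg α⟩
    · rintro ⟨β, hβ, rfl⟩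
      exact key hw hu hβ
  rw [separation, separation, himg, Set.ncard_image_of_injective _ neg_injective]

theorem reflexion_separation (hw : w ∈ C) (h1 : Walk S n w u) (hx : w.Reflectable x)
    (hpos : u.Pos (w.b x)) : separation C (w.reflexion x) u = separation C w u + 1 := by
  have hu := h1.mem hC hw
  rw [hC.separation_comm (hC.reflexion_mem hw hx) hu, hC.separation_comm hw hu]
  exact hC.separation_reflexion hu h1.symm hx hpos

theorem separation_of_not_pos' (hw : w ∈ C) (h1 : Walk S n w u) (hx : w.Reflectable x)
    (hneg : ¬ u.Pos (w.b x)) : separation C w u = separation C (w.reflexion x) u + 1 := by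
  have hu := h1.mem hC hw
  rw [hC.separation_comm (hC.reflexion_mem hw hx) hu, hC.separation_comm hw hu]
  exact hC.separation_of_not_pos hu h1.symm hx hneg

/-- The separation of the ends of a walk is at most its length, and of the same parity. -/
theorem exists_length_eq (hw : w ∈ C) (h1 : Walk S n w u) :
    ∃ k, n = separation C w u + 2 * k := by
  induction n generalizing u with
  | zero => cases h1; exact ⟨0, by rw [separation_self]⟩
  | succ n ih =>
    obtain ⟨t, x, _, hr, h2, rfl⟩ := h1.exists_last
    obtain ⟨k, hk⟩ := ih h2
    by_cases hpos : w.Pos (t.b x)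
    · exact ⟨k, by rw [hC.separation_reflexion hw h2 hr hpos]; omega⟩
    · have := hC.separation_of_not_pos hw h2 hr hpos
      exact ⟨k + 1, by omega⟩

/-- A simple root that changes sign along a walk is crossed by it, hence reflectable; so counting
reflectable roots controls all simple roots. -/
theorem pos_of_separation_eq_zero (hw : w ∈ C) (h1 : Walk S n w u) (h0 : separation C w u = 0)
    (hα : α ∈ simpleRoots C) (hpos : w.Pos α) : u.Pos α := by
  by_contra hneg
  have hmem : α ∈ inversions C w u :=
    ⟨hC.mem_reflectableRoots_of_walk hw h1 hα hpos hneg, hpos, hneg⟩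
  rw [(Set.ncard_eq_zero (hC.finite_inversions hw h1)).1 h0] at hmem
  exact hmem

end CommonRoots

end SuperRootDatum

/-! ### Residues of rank two. -/

namespace SuperRootDatum

variable {X : Type v} {h : Type u} [AddCommGroup h] [Module ℂ h]

/-- The simple roots of `t` are obtained from those of `w` by a linear change of determinant `ε`
in the plane of `b x, b y`, which also acts on the coroots after rescaling by `r`. -/
structure PlanarChange (x y : X) (r ε : ℂ) (w t : SuperRootDatum X h) : Prop where
  plane : ∃ n n' m m' : ℂ, t.b x = n • w.b x + n' • w.b y ∧ t.b y = m • w.b x + m' • w.b y ∧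
    t.a x = n • w.a x + (n' * r) • w.a y ∧ t.a y = (m / r) • w.a x + m' • w.a y ∧
    n * m' - n' * m = ε
  b_eq : ∀ z, ∃ k k' : ℂ, t.b z = w.b z + k • w.b x + k' • w.b y
  a_eq : ∀ z, ∃ k k' : ℂ, t.a z = w.a z + k • w.a x + k' • w.a y

variable {x y : X} {r ε : ℂ} {w t : SuperRootDatum X h}

theorem PlanarChange.refl (x y : X) (r : ℂ) (w : SuperRootDatum X h) :
    PlanarChange x y r 1 w w where
  plane := ⟨1, 0, 0, 1, by simp⟩
  b_eq z := ⟨0, 0, by simp⟩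
  a_eq z := ⟨0, 0, by simp⟩

theorem PlanarChange.swap (hp : PlanarChange x y r ε w t) :
    PlanarChange y x r⁻¹ ε w t where
  plane := by
    obtain ⟨n, n', m, m', h1, h2, h3, h4, h5⟩ := hp.plane
    refine ⟨m', m, n', n, by rw [h2, add_comm], by rw [h1, add_comm], by rw [h4, add_comm]; rfl,
      by rw [h3, add_comm, div_inv_eq_mul], by rw [← h5]; ring⟩
  b_eq z := by
    obtain ⟨k, k', hk⟩ := hp.b_eq z
    exact ⟨k', k, by rw [hk, add_right_comm]⟩
  a_eq z := by
    obtain ⟨k, k', hk⟩ := hp.a_eq z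
    exact ⟨k', k, by rw [hk, add_right_comm]⟩

variable [DecidableEq X]

/-- The ratio `r` symmetrizes the rank two Cartan block: the pair `a x`, `r • a y` undergoes the
same shear as `b x`, `b y`, in the isotropic and anisotropic cases alike. -/
theorem exists_reflexion_eq_of_ratio (hr : r ≠ 0) (hxy : y ≠ x)
    (hsym : w.cartan x y = r * w.cartan y x) :
    ∃ k : ℂ, (w.reflexion x).b y = w.b y + k • w.b x ∧
      (w.reflexion x).a y = w.a y + (k / r) • w.a x := by
  by_cases h0 : w.cartan x x = 0
  · by_cases h1 : w.cartan x y = 0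
    · refine ⟨0, ?_, ?_⟩
      · rw [reflexion_b_of_isotropic_of_eq h0 hxy h1]; simp
      · rw [reflexion_a_of_isotropic_of_eq h0 hxy h1]; simp
    · refine ⟨1, ?_, ?_⟩
      · rw [reflexion_b_of_isotropic_of_ne h0 hxy h1]; simp
      · have h2 : w.cartan y x ≠ 0 := by
          intro h2; rw [h2, mul_zero] at hsym; exact h1 hsym
        rw [reflexion_a_of_isotropic_of_ne h0 hxy h1, hsym]
        congr 2
        field_simp
  · refine ⟨-(2 * w.cartan x y / w.cartan x x), ?_, ?_⟩
    · rw [reflexion_b_of_anisotropic h0]; module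
    · rw [reflexion_a_of_anisotropic h0, hsym, sub_eq_add_neg, ← neg_smul]
      congr 2
      field_simp

theorem cartan_reflexion_ratio (hxy : y ≠ x) (hsym : w.cartan x y = r * w.cartan y x) :
    (w.reflexion x).cartan x y = r * (w.reflexion x).cartan y x := by
  by_cases h0 : w.cartan x x = 0
  · rw [cartan_reflexion_left_of_isotropic h0 hxy, cartan_reflexion_right_of_isotropic h0 hxy, hsym]
    ring
  · rw [cartan_reflexion_left_of_anisotropic h0, cartan_reflexion_right_of_anisotropic h0, hsym]

theorem PlanarChange.of_reflexion (hr : r ≠ 0) (hxy : y ≠ x)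
    (hsym : w.cartan x y = r * w.cartan y x)
    (hp : PlanarChange x y r ε (w.reflexion x) t) : PlanarChange x y r (-ε) w t where
  plane := by
    obtain ⟨n, n', m, m', h1, h2, h3, h4, h5⟩ := hp.plane
    obtain ⟨k, hb, ha⟩ := exists_reflexion_eq_of_ratio hr hxy hsym
    refine ⟨n' * k - n, n', m' * k - m, m', ?_, ?_, ?_, ?_, by rw [← h5]; ring⟩
    · rw [h1, hb, reflexion_b_self]; module
    · rw [h2, hb, reflexion_b_self]; module
    · rw [h3, ha, reflexion_a_self]
      match_scalars <;> field_simp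
      ring
    · rw [h4, ha, reflexion_a_self]
      match_scalars <;> field_simp
      ring
  b_eq z := by
    obtain ⟨k, k', hk⟩ := hp.b_eq z
    obtain ⟨c, hc⟩ := w.exists_reflexion_b_eq x z
    obtain ⟨d, hd⟩ := w.exists_reflexion_b_eq x y
    refine ⟨c - k + k' * d, k', ?_⟩
    rw [hk, hc, hd, reflexion_b_self]; module
  a_eq z := by
    obtain ⟨k, k', hk⟩ := hp.a_eq z
    obtain ⟨c, hc⟩ := w.exists_reflexion_a_eq x z
    obtain ⟨d, hd⟩ := w.exists_reflexion_a_eq x y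
    refine ⟨c - k + k' * d, k', ?_⟩
    rw [hk, hc, hd, reflexion_a_self]; module

/-- The ratio survives reflexions at `x` and `y`, so the planar changes compose, each reflexion
contributing determinant `-1`. Exchanging the labels inverts `r`. -/
theorem Walk.planarChange {n : ℕ} (hr : r ≠ 0) (hxy : x ≠ y) (h1 : Walk {x, y} n w t)
    (hsym : w.cartan x y = r * w.cartan y x) : PlanarChange x y r ((-1) ^ n) w t := by
  induction h1 with
  | nil w => simpa using PlanarChange.refl x y r w
  | @cons n w _ z hz _ _ ih =>
    rw [pow_succ, mul_neg_one]
    rcases hz with rfl | hz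
    · exact PlanarChange.of_reflexion hr hxy.symm hsym (ih (cartan_reflexion_ratio hxy.symm hsym))
    · rw [Set.mem_singleton_iff] at hz
      subst hz
      have hr' : r⁻¹ ≠ 0 := inv_ne_zero hr
      have hsym' : w.cartan z x = r⁻¹ * w.cartan x z := by
        rw [hsym, inv_mul_cancel_left₀ hr]
      have h2 : (w.reflexion z).cartan x z = r * (w.reflexion z).cartan z x := by
        rw [cartan_reflexion_ratio hxy hsym', mul_inv_cancel_left₀ hr]
      have h3 := (PlanarChange.of_reflexion hr' hxy hsym' (ih h2).swap).swap
      rwa [inv_inv] at h3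

/-- A walk with labels `x, y` moves the roots `b x`, `b y` inside their span. -/
theorem Walk.b_mem_span {n : ℕ} (h1 : Walk {x, y} n w t) {z : X} (hz : z ∈ ({x, y} : Set X)) :
    t.b z ∈ Submodule.span ℂ {w.b x, w.b y} := by
  induction h1 with
  | nil w =>
    rcases hz with rfl | hz
    · exact Submodule.subset_span (by simp)
    · rw [Set.mem_singleton_iff] at hz
      subst hz
      exact Submodule.subset_span (by simp)
  | @cons n w _ q hq _ _ ih =>
    refine Submodule.span_le.2 ?_ ih
    have hw : ∀ s ∈ ({x, y} : Set X), w.b s ∈ Submodule.span ℂ {w.b x, w.b y} := by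
      rintro s (rfl | hs)
      · exact Submodule.subset_span (by simp)
      · rw [Set.mem_singleton_iff] at hs
        subst hs
        exact Submodule.subset_span (by simp)
    have key : ∀ s ∈ ({x, y} : Set X),
        (w.reflexion q).b s ∈ Submodule.span ℂ {w.b x, w.b y} := by
      intro s hs
      obtain ⟨c, hc⟩ := w.exists_reflexion_b_eq q s
      rw [hc]
      exact Submodule.add_mem _ (hw s hs) (Submodule.smul_mem _ _ (hw q hq))
    rintro _ (rfl | hs)
    · exact key x (by simp)
    · rw [Set.mem_singleton_iff] at hs
      subst hs
      exact key y (by simp)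

theorem eq_zero_of_natCast_of_neg {c : ℂ} (h1 : ∃ n : ℕ, c = n) (h2 : ∃ n : ℕ, -c = n) :
    c = 0 := by
  obtain ⟨m, hm⟩ := h1
  obtain ⟨n, hn⟩ := h2
  have : m + n = 0 := by exact_mod_cast (by linear_combination -hm - hn : (m : ℂ) + n = 0)
  rw [hm, show m = 0 by omega, Nat.cast_zero]

namespace CommonRoots

variable {C : Set (SuperRootDatum X h)} {Δ : Set (Module.Dual ℂ h)} (hC : CommonRoots C Δ)

include hC

/-- Rank two walks have no monodromy. -/
theorem eq_of_walk_pair {n : ℕ} (hr : r ≠ 0) (hxy : x ≠ y) (hw : w ∈ C) (h1 : Walk {x, y} n w t)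
    (hsym : w.cartan x y = r * w.cartan y x) (h0 : separation C w t = 0) : t = w := by
  have ht := h1.mem hC hw
  have hpw : ∀ z, w.Pos (t.b z) := fun z => hC.pos_of_separation_eq_zero ht h1.symm
    (by rw [← hC.separation_comm hw ht, h0]) ⟨t, ht, z, rfl⟩ (t.pos_b z)
  have hpt : ∀ z, t.Pos (w.b z) := fun z => hC.pos_of_separation_eq_zero hw h1 h0
    ⟨w, hw, z, rfl⟩ (w.pos_b z)
  have hp := h1.planarChange hr hxy hsym
  -- The length has the parity of the separation, which is zero. Determinant one rules out an
  -- exchange of `b x` and `b y`, and makes the adjugate the inverse matrix.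
  have hε : (-1 : ℂ) ^ n = 1 := by
    obtain ⟨k, hk⟩ := hC.exists_length_eq hw h1
    rw [hk, h0, zero_add, pow_mul]; simp
  obtain ⟨n, n', m, m', hbx, hby, hax, hay, hdet⟩ := hp.plane
  rw [hε] at hdet
  have hinvx : w.b x = m' • t.b x + (-n') • t.b y := by
    calc w.b x = (n * m' - n' * m) • w.b x := by rw [hdet, one_smul]
      _ = m' • (n • w.b x + n' • w.b y) + (-n') • (m • w.b x + m' • w.b y) := by
        module
      _ = _ := by rw [← hbx, ← hby]
  have hinvy : w.b y = (-m) • t.b x + n • t.b y := by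
    calc w.b y = (n * m' - n' * m) • w.b y := by rw [hdet, one_smul]
      _ = (-m) • (n • w.b x + n' • w.b y) + n • (m • w.b x + m' • w.b y) := by
        module
      _ = _ := by rw [← hbx, ← hby]
  have hcomb : ∀ (s : SuperRootDatum X h) (c d : ℂ), s.coord x (c • s.b x + d • s.b y) = c ∧
      s.coord y (c • s.b x + d • s.b y) = d := by
    intro s c d
    constructor
    · rw [map_add, map_smul, map_smul, coord_b_self, coord_b_ne s hxy.symm]; simp
    · rw [map_add, map_smul, map_smul, coord_b_self, coord_b_ne s hxy]; simp
  -- An off-diagonal entry occurs in the change of basis and, negated, in its inverse; both are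
  -- natural numbers.
  have hn' : n' = 0 := by
    refine eq_zero_of_natCast_of_neg ?_ ?_
    · have := (hpw x).exists_coord_eq y
      rwa [hbx, (hcomb w n n').2] at this
    · have := (hpt x).exists_coord_eq y
      rwa [hinvx, (hcomb t m' (-n')).2] at this
  have hm : m = 0 := by
    refine eq_zero_of_natCast_of_neg ?_ ?_
    · have := (hpw y).exists_coord_eq x
      rwa [hby, (hcomb w m m').1] at this
    · have := (hpt y).exists_coord_eq x
      rwa [hinvy, (hcomb t (-m) n).1] at this
  rw [hn', zero_mul, sub_zero] at hdet
  have hnm : n = 1 ∧ m' = 1 := by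
    have h2 := (hpw x).exists_coord_eq x
    rw [hbx, (hcomb w n n').1] at h2
    have h3 := (hpw y).exists_coord_eq y
    rw [hby, (hcomb w m m').2] at h3
    obtain ⟨i, hi⟩ := h2
    obtain ⟨j, hj⟩ := h3
    have hij : i * j = 1 := by
      rw [hi, hj] at hdet; exact_mod_cast hdet
    rw [hi, hj, Nat.eq_one_of_mul_eq_one_right hij, Nat.eq_one_of_mul_eq_one_left hij]
    simp
  rw [hnm.1, hn'] at hbx hax
  rw [hnm.2, hm] at hby hay
  have hbx' : t.b x = w.b x := by rw [hbx]; simp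
  have hby' : t.b y = w.b y := by rw [hby]; simp
  have hb : ∀ z, t.b z = w.b z := by
    intro z
    by_cases hzx : z = x
    · rw [hzx, hbx']
    by_cases hzy : z = y
    · rw [hzy, hby']
    obtain ⟨k, k', hk⟩ := hp.b_eq z
    have hk' : w.b z = t.b z + (-k) • t.b x + (-k') • t.b y := by
      rw [hk, hbx', hby']; module
    have hcoord : ∀ (s : SuperRootDatum X h) (c d : ℂ),
        s.coord x (s.b z + c • s.b x + d • s.b y) = c ∧
        s.coord y (s.b z + c • s.b x + d • s.b y) = d := by
      intro s c d
      rw [add_assoc, map_add _ (s.b z), map_add _ (s.b z), (hcomb s c d).1, (hcomb s c d).2,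
        coord_b_ne s hzx, coord_b_ne s hzy]
      simp
    have h2 : k = 0 := by
      refine eq_zero_of_natCast_of_neg ?_ ?_
      · have := (hpw z).exists_coord_eq x
        rwa [hk, (hcoord w k k').1] at this
      · have := (hpt z).exists_coord_eq x
        rwa [hk', (hcoord t (-k) (-k')).1] at this
    have h3 : k' = 0 := by
      refine eq_zero_of_natCast_of_neg ?_ ?_
      · have := (hpw z).exists_coord_eq y
        rwa [hk, (hcoord w k k').2] at this
      · have := (hpt z).exists_coord_eq y
        rwa [hk', (hcoord t (-k) (-k')).2] at this
    rw [hk, h2, h3]; simp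
  have ha : ∀ z, t.a z = w.a z := by
    intro z
    by_cases hzx : z = x
    · rw [hzx, hax]; simp
    by_cases hzy : z = y
    · rw [hzy, hay]; simp
    obtain ⟨k, k', hk⟩ := hp.a_eq z
    -- Equality of roots gives the coroot only up to `c`; the planar form has coefficient one at
    -- `w.a z`, which forces `c = 1`.
    obtain ⟨c, hc⟩ := hC.a_eq ht hw (hb z)
    obtain ⟨f, hf⟩ := w.linInd_a.exists_linearMap_apply_eq fun s => if s = z then 1 else 0
    have h2 := congrArg f (hc.symm.trans hk)
    simp only [map_add, map_smul, hf, if_true, if_neg (Ne.symm hzx), if_neg (Ne.symm hzy),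
      smul_eq_mul, mul_one, mul_zero, add_zero] at h2
    rw [hc, h2, one_smul]
  ext1
  · exact funext ha
  · exact funext hb
  · exact funext fun z => hC.p_eq ht hw (hb z)

end CommonRoots

end SuperRootDatum

/-! ### Distance equals separation. -/

namespace SuperRootDatum

variable {X : Type v} {h : Type u} [AddCommGroup h] [Module ℂ h]
  {w u t : SuperRootDatum X h} {x y : X} {α : Module.Dual ℂ h}

/-- A positive element of the plane of two simple roots is a sum of them. -/
theorem Pos.exists_eq_of_mem_span_pair (hpos : t.Pos α) (hxy : x ≠ y)
    (hα : α ∈ Submodule.span ℂ {t.b x, t.b y}) :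
    ∃ i j : ℕ, α = i • t.b x + j • t.b y := by
  obtain ⟨c, d, rfl⟩ := Submodule.mem_span_pair.1 hα
  obtain ⟨i, hi⟩ := hpos.exists_coord_eq x
  obtain ⟨j, hj⟩ := hpos.exists_coord_eq y
  rw [map_add, map_smul, map_smul, coord_b_self, coord_b_ne t hxy.symm] at hi
  rw [map_add, map_smul, map_smul, coord_b_self, coord_b_ne t hxy] at hj
  refine ⟨i, j, ?_⟩
  rw [← Nat.cast_smul_eq_nsmul ℂ, ← Nat.cast_smul_eq_nsmul ℂ, ← hi, ← hj]
  simp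

variable [DecidableEq X]

namespace CommonRoots

variable {C : Set (SuperRootDatum X h)} {Δ : Set (Module.Dual ℂ h)} (hC : CommonRoots C Δ)

include hC

theorem exists_ratio (hw : w ∈ C) (hx : w.Reflectable x) (hy : w.Reflectable y) (hxy : x ≠ y) :
    ∃ r : ℂ, r ≠ 0 ∧ w.cartan x y = r * w.cartan y x := by
  by_cases h0 : w.cartan x y = 0
  · exact ⟨1, one_ne_zero, by rw [h0, hC.cartan_eq_zero hw hx hy hxy h0, mul_zero]⟩
  · have h1 : w.cartan y x ≠ 0 := fun h1 => h0 (hC.cartan_eq_zero hw hy hx hxy.symm h1)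
    exact ⟨w.cartan x y / w.cartan y x, div_ne_zero h0 h1, (div_mul_cancel₀ _ h1).symm⟩

/-- Rank two walks can be replaced by walks of minimal length. -/
theorem walk_pair_separation {r : ℂ} {n : ℕ} (hr : r ≠ 0) (hxy : x ≠ y) (hw : w ∈ C)
    (hsym : w.cartan x y = r * w.cartan y x) (h1 : Walk {x, y} n w t) :
    Walk {x, y} (separation C w t) w t := by
  -- The induction is on the separation alone, so the auxiliary walk may grow.
  suffices key : ∀ k, ∀ n t, Walk {x, y} n w t → separation C w t = k → Walk {x, y} k t w from
    (key _ n t h1 rfl).symm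
  intro k
  induction k with
  | zero =>
    intro n t h1 h0
    rw [hC.eq_of_walk_pair hr hxy hw h1 hsym h0]
    exact Walk.nil w
  | succ k ih =>
    intro n t h1 hk
    have ht := h1.mem hC hw
    -- An inversion is crossed by the walk, hence lies in the plane, and its negative is a natural
    -- combination of `t.b x` and `t.b y`; these cannot both be positive for `w`.
    obtain ⟨q, hq, hneg⟩ : ∃ q ∈ ({x, y} : Set X), ¬ w.Pos (t.b q) := by
      by_contra! hall
      obtain ⟨α, hα, hαw, hαt⟩ := Set.nonempty_of_ncard_ne_zero
        (s := inversions C w t) (by rw [← separation, hk]; omega)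
      obtain ⟨s, hs, q, hq, _, rfl, m, hm⟩ :=
        hC.exists_crossing hw h1 (reflectableRoots_subset C hα) hαw hαt
      have hspan := (h1.symm.trans hm).b_mem_span hq
      have hneg := (hC.pos_neg_iff ht (hC.b_mem hs q)).2 hαt
      obtain ⟨i, j, hij⟩ := hneg.exists_eq_of_mem_span_pair hxy (Submodule.neg_mem _ hspan)
      refine hC.ne_zero (hC.b_mem hs q) (hαw.eq_zero ?_)
      rw [hij]
      exact ((hall x (by simp)).nsmul i).add ((hall y (by simp)).nsmul j)
    have hqr : t.Reflectable q := hC.reflectable_of_mem ht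
      (hC.mem_reflectableRoots_of_walk ht h1.symm ⟨t, ht, q, rfl⟩ (t.pos_b q) hneg)
    have h2 := hC.separation_of_not_pos hw h1 hqr hneg
    exact Walk.cons hq hqr (ih (n + 1) _ (h1.snoc hq hqr) (by omega))

/-- If `b x` is simple for `u` too and `b y` is negative for `u`, then the roots in the plane of
`b x, b y` that are positive for `w` and other than `b x` are negative for `u`. -/
theorem not_pos_of_mem_plane {z : X} (hw : w ∈ C) (hu : u ∈ C) (hxy : x ≠ y)
    (hy : w.Reflectable y) (hz : u.b z = w.b x) (hneg : ¬ u.Pos (w.b y))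
    (hα : α ∈ simpleRoots C) (hspan : α ∈ Submodule.span ℂ {w.b x, w.b y}) (hpos : w.Pos α)
    (hne : α ≠ w.b x) : ¬ u.Pos α := by
  intro hαu
  obtain ⟨i, j, rfl⟩ := hpos.exists_eq_of_mem_span_pair hxy hspan
  have hj : j ≠ 0 := by
    rintro rfl
    refine hne (hC.eq_b_of_coord hw hα hpos fun s hs => ?_)
    rw [zero_smul, add_zero, map_nsmul, coord_b_ne w (Ne.symm hs), smul_zero]
  have hneg' := (hC.pos_neg_iff hu (hC.b_mem hw y)).2 hneg
  have hyR : w.b y ∈ reflectableRoots C := ⟨w, hw, y, hy, rfl⟩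
  -- At `s ≠ z` the `u`-coefficient of the root in question is `j` times that of `b y`; the former
  -- is nonnegative and the latter nonpositive, and `j > 0`, so both vanish.
  have h1 : -w.b y = u.b z := by
    refine hC.eq_b_of_coord hu (reflectableRoots_subset C (hC.neg_mem_reflectableRoots hyR)) hneg'
      fun s hs => ?_
    obtain ⟨m, hm⟩ := hneg'.exists_coord_eq s
    obtain ⟨n, hn⟩ := hαu.exists_coord_eq s
    rw [map_neg] at hm
    rw [map_add, map_nsmul, map_nsmul, ← hz, coord_b_ne u (Ne.symm hs), smul_zero, zero_add,
      nsmul_eq_mul] at hn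
    have h2 : j * m + n = 0 := by
      have : (j : ℂ) * m + n = 0 := by rw [← hm, ← hn]; ring
      exact_mod_cast this
    have h3 : m = 0 := (Nat.mul_eq_zero.1 (by omega : j * m = 0)).resolve_left hj
    rw [map_neg, hm, h3, Nat.cast_zero]
  rw [hz] at h1
  exact hC.ne_zero (hC.b_mem hw y) ((w.pos_b y).eq_zero (h1 ▸ w.pos_b x))

/-- The walk in the `{x, y}`-residue of `w` that moves towards `u` until `b x`, which is simple for
`w` and for `u`, is simple again. -/
theorem exists_residue_walk {z : X} {k : ℕ} (hw : w ∈ C) (hu : u ∈ C) (hxy : x ≠ y)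
    (hy : w.Reflectable y) (hz : u.b z = w.b x) (hneg : ¬ u.Pos (w.b y))
    (hT : ∀ n s, n ≤ k + 1 → s ∈ C → Walk Set.univ n s u →
      Walk Set.univ (separation C s u) s u)
    {i j : ℕ} (h1 : Walk {x, y} i w t) (hpos : t.Pos (w.b x))
    (hsum : separation C w t + separation C t u = k + 1) (hj : separation C t u = j) (hjk : j ≤ k)
    (h2 : Walk Set.univ j t u) :
    ∃ s q, q ∈ ({x, y} : Set X) ∧ (∃ i, Walk {x, y} i w s) ∧ s.b q = w.b x ∧
      separation C w s + separation C s u = k + 1 ∧ separation C s u ≤ k ∧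
      Walk Set.univ (separation C s u) s u := by
  induction j using Nat.strong_induction_on generalizing t i with
  | _ j ih =>
  have ht := h1.mem hC hw
  by_cases hsimple : ∃ q ∈ ({x, y} : Set X), t.b q = w.b x
  · obtain ⟨q, hq, hb⟩ := hsimple
    exact ⟨t, q, hq, ⟨i, h1⟩, hb, hsum, hj ▸ hjk, hj ▸ h2⟩
  push Not at hsimple
  have hxS : x ∈ ({x, y} : Set X) := by simp
  have hyS : y ∈ ({x, y} : Set X) := by simp
  -- Otherwise `b x`, a natural combination of `t.b x` and `t.b y`, would be negative for `w`.
  obtain ⟨q, hq, hqpos⟩ : ∃ q ∈ ({x, y} : Set X), w.Pos (t.b q) := by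
    by_contra! hall
    obtain ⟨i, j, hij⟩ := hpos.exists_eq_of_mem_span_pair hxy (h1.symm.b_mem_span hxS)
    have hn : ∀ q ∈ ({x, y} : Set X), w.Pos (-t.b q) := fun q hq =>
      (hC.pos_neg_iff hw (hC.b_mem ht q)).2 (hall q hq)
    have h3 : w.Pos (-w.b x) := by
      rw [hij, neg_add, ← smul_neg, ← smul_neg]
      exact ((hn x hxS).nsmul i).add ((hn y hyS).nsmul j)
    exact hC.ne_zero (hC.b_mem hw x) ((w.pos_b x).eq_zero h3)
  have hqneg : ¬ u.Pos (t.b q) := hC.not_pos_of_mem_plane hw hu hxy hy hz hneg ⟨t, ht, q, rfl⟩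
    (h1.b_mem_span hq) hqpos (hsimple q hq)
  have hqr : t.Reflectable q := hC.reflectable_of_mem ht
    (hC.mem_reflectableRoots_of_walk ht h2 ⟨t, ht, q, rfl⟩ (t.pos_b q) hqneg)
  have ht2 := hC.reflexion_mem ht hqr
  -- Reflecting at `q` leads away from `w` and towards `u`: the sum of separations is kept and the
  -- second one drops, which ends the recursion.
  have hs1 := hC.separation_reflexion hw h1 hqr hqpos
  have hs2 := hC.separation_of_not_pos' ht h2 hqr hqneg
  have hback : Walk Set.univ 1 (t.reflexion q) t := (Walk.single (Set.mem_univ _) hqr).symm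
  have h3 := hT _ _ (by omega) ht2 (hback.trans h2)
  exact ih (separation C (t.reflexion q) u) (by omega) (h1.snoc hq hqr)
    (hC.pos_reflexion ht hqr ⟨w, hw, x, rfl⟩ (hsimple q hq).symm hpos) (by omega) rfl (by omega) h3

/-- Walks can be replaced by walks whose length is the separation of the ends. -/
theorem walk_separation {n : ℕ} (hw : w ∈ C) (h1 : Walk Set.univ n w u) :
    Walk Set.univ (separation C w u) w u := by
  induction n using Nat.strong_induction_on generalizing w u with
  | _ n ih =>
  cases h1 with
  | nil =>
    rw [separation_self]
    exact Walk.nil w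
  | @cons n _ _ x _ hx htail =>
  have hw1 := hC.reflexion_mem hw hx
  obtain ⟨k, hk⟩ := hC.exists_length_eq hw1 htail
  have hred := ih n (by omega) hw1 htail
  -- If the tail exceeds its separation, shortening it already brings the walk within the induction
  -- hypothesis.
  rcases Nat.eq_zero_or_pos k with rfl | hk0
  swap
  · exact ih (separation C (w.reflexion x) u + 1) (by omega) hw (Walk.cons (Set.mem_univ _) hx hred)
  rw [mul_zero, add_zero] at hk
  by_cases hpos : u.Pos (w.b x)
  swap
  · rw [hC.separation_of_not_pos' hw (Walk.cons (Set.mem_univ _) hx htail) hx hpos]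
    exact Walk.cons (Set.mem_univ _) hx hred
  have hsep := hC.reflexion_separation hw (Walk.cons (Set.mem_univ _) hx htail) hx hpos
  obtain ⟨m, rfl⟩ : ∃ m, n = m + 1 := ⟨separation C w u, by omega⟩
  obtain ⟨u', z, _, hz, htail', rfl⟩ := htail.exists_last
  have hu' := htail'.mem hC hw1
  -- In the remaining case the tail crosses `γ = -w.b x` back again; the question is at which step.
  have hγ : (w.reflexion x).b x = -w.b x := w.reflexion_b_self x
  have hγpos : ∀ {s}, s ∈ C → (s.Pos ((w.reflexion x).b x) ↔ ¬ s.Pos (w.b x)) := fun {s} hs => by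
    rw [hγ]; exact hC.pos_neg_iff hs (hC.b_mem hw x)
  have hw1x : (w.reflexion x).Reflectable x := hx.reflexion
  -- If `γ` is recrossed before the last step, the walk from `w` to `u'` is too long and shortens by
  -- induction.
  by_cases hcross : u'.Pos (w.b x)
  · have h2 := hC.reflexion_separation hw (Walk.cons (Set.mem_univ _) hx htail') hx hcross
    obtain ⟨k, hk'⟩ := hC.exists_length_eq hw1 htail'
    have h3 := ih (m + 1) (by omega) hw (Walk.cons (Set.mem_univ _) hx htail')
    exact ih (separation C w u' + 1) (by omega) hw (h3.snoc (Set.mem_univ _) hz)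
  have hzb : u'.b z = (w.reflexion x).b x := by
    by_contra hne
    exact (hγpos (hC.reflexion_mem hu' hz)).1 (hC.pos_reflexion hu' hz ⟨_, hw1, x, rfl⟩
      (Ne.symm hne) ((hγpos hu').2 hcross)) hpos
  cases htail' with
  | nil =>
    have hzx : z = x := (w.reflexion x).linInd_b.injective hzb
    rw [hzx, reflexion_reflexion, separation_self]
    exact Walk.nil w
  | @cons k _ _ y _ hy htail2 =>
  have htail' : Walk Set.univ (k + 1) (w.reflexion x) u' := Walk.cons (Set.mem_univ _) hy htail2
  have hw2 := hC.reflexion_mem hw1 hy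
  have hle := hC.separation_reflexion_le hw1 htail' hz
  obtain ⟨k1, hk1⟩ := hC.exists_length_eq hw2 htail2
  obtain ⟨k2, hk2⟩ := hC.exists_length_eq hw1 htail'
  -- The tail is as short as its separation, hence so is `htail'`, and its first step must approach
  -- `u'`.
  have hyneg : ¬ u'.Pos ((w.reflexion x).b y) := by
    intro h2
    have := hC.reflexion_separation hw1 htail' hy h2
    omega
  have hxy : x ≠ y := by
    rintro rfl
    exact hyneg ((hγpos hu').2 hcross)
  have hs2 := hC.separation_of_not_pos' hw1 htail' hy hyneg
  have hstep1 : Walk {x, y} 1 (w.reflexion x) ((w.reflexion x).reflexion y) :=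
    Walk.single (by simp) hy
  have hs1 := hC.separation_reflexion hw1 (Walk.nil (S := Set.univ) (w.reflexion x)) hy
    ((w.reflexion x).pos_b y)
  rw [separation_self] at hs1
  have hpos2 : ((w.reflexion x).reflexion y).Pos ((w.reflexion x).b x) :=
    hC.pos_reflexion hw1 hy ⟨_, hw1, x, rfl⟩
      (fun hb => hxy ((w.reflexion x).linInd_b.injective hb)) ((w.reflexion x).pos_b x)
  -- Since `γ` is simple at `w.reflexion x` and at `u'`, the residue contains a vertex `t`, nearer
  -- to `u'`, where it is simple again; recrossing `γ` at `t` splits the problem into a rank two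
  -- part and a shorter one.
  obtain ⟨t, q, hq, ⟨i, hwt⟩, htq, hsum, hlek, htu'⟩ := hC.exists_residue_walk (k := k) hw1 hu' hxy
    hy hzb hyneg (fun n s hn hs h2 => ih n (by omega) hs h2) hstep1 hpos2 (by omega)
    (show separation C ((w.reflexion x).reflexion y) u' = k by omega) le_rfl htail2
  have ht := hwt.mem hC hw1
  have hqr : t.Reflectable q := hC.reflectable_of_mem ht (by
    rw [htq]; exact ⟨_, hw1, x, hw1x, rfl⟩)
  obtain ⟨r, hr, hsym⟩ := hC.exists_ratio hw1 hw1x hy hxy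
  have hsym' := cartan_reflexion_ratio hxy.symm hsym
  rw [reflexion_reflexion] at hsym'
  have hwt' : Walk {x, y} (i + 1) w t := Walk.cons (by simp) hx hwt
  have hfirst := (hC.walk_pair_separation hr hxy hw hsym' (hwt'.snoc hq hqr)).mono
    (Set.subset_univ _)
  have htu := htu'.snoc (Set.mem_univ _) hz
  have hback : Walk Set.univ 1 (t.reflexion q) t := (Walk.single (Set.mem_univ _) hqr).symm
  have hsecond := ih _ (by omega) (hC.reflexion_mem ht hqr) (hback.trans htu)
  have htpos : ¬ t.Pos (w.b x) := (hγpos ht).1 (by rw [← htq]; exact t.pos_b q)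
  have e1 := hC.separation_of_not_pos' hw hwt' hx htpos
  have e2 := hC.separation_of_not_pos hw hwt' hqr (by
    rw [htq, hγpos hw]; exact fun h2 => h2 (w.pos_b x))
  have e3 := hC.separation_of_not_pos' ht htu hqr (by
    rw [htq, hγpos (hC.reflexion_mem hu' hz)]; exact fun h2 => h2 hpos)
  have e4 := hC.separation_reflexion_le ht htu' hz
  -- Neither part crosses `γ` any longer: the total is at most `k + 1`, against the original `k +
  -- 3`.
  exact ih _ (by omega) hw (hfirst.trans hsecond)

end CommonRoots

end SuperRootDatum

/-! ### Transport of paths and the exchange condition. -/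

namespace SuperRootDatum

variable {X : Type v} {h : Type u} [AddCommGroup h] [Module ℂ h]

theorem cartan_transport (w : SuperRootDatum X h) (θ : h ≃ₗ[ℂ] h) (x y : X) :
    (w.transport θ).cartan x y = w.cartan x y := by
  simp [cartan, transport]

theorem Reflectable.transport {w : SuperRootDatum X h} {x : X} (hx : w.Reflectable x)
    (θ : h ≃ₗ[ℂ] h) : (w.transport θ).Reflectable x := by
  have hp : (w.transport θ).p = w.p := rfl
  simpa only [Reflectable, cartan_transport, hp] using hx

/-- The formula for the reflection is homogeneous of degree zero in the coroot, so a coroot known up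
to a scalar suffices. -/
theorem linearReflection_congr {w w' : SuperRootDatum X h} {x x' : X} (hx : w.Anisotropic x)
    (hx' : w'.Anisotropic x') {c : ℂ} (ha : w.a x = c • w'.a x') (hb : w.b x = w'.b x') :
    w.linearReflection x hx = w'.linearReflection x' hx' := by
  have hcar : w.cartan x x = c * w'.cartan x' x' := by
    rw [cartan, cartan, ha, hb, map_smul, smul_eq_mul]
  have hc : c ≠ 0 := by
    rintro rfl
    exact hx (by rw [hcar, zero_mul])
  have h0 : w'.cartan x' x' ≠ 0 := hx'
  ext t
  rw [linearReflection_apply, linearReflection_apply, hb, ha, hcar, smul_smul]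
  congr 2
  field_simp

variable [DecidableEq X]

theorem reflexion_transport (w : SuperRootDatum X h) (θ : h ≃ₗ[ℂ] h) (x : X) :
    (w.transport θ).reflexion x = (w.reflexion x).transport θ := by
  ext1 <;> funext y
  · change (w.transport θ).reflA x y = θ (w.reflA x y)
    simp only [reflA, cartan_transport]
    split_ifs <;> simp [SuperRootDatum.transport]
  · change (w.transport θ).reflB x y = (w.reflB x y).comp θ.symm.toLinearMap
    simp only [reflB, cartan_transport]
    split_ifs <;> ext t <;> simp [SuperRootDatum.transport]
  · change (w.transport θ).reflP x y = w.reflP x y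
    simp only [reflP, cartan_transport]
    rfl

theorem IsPath.transport {w : SuperRootDatum X h} {l : List X} (hl : w.IsPath l)
    (θ : h ≃ₗ[ℂ] h) : (w.transport θ).IsPath l := by
  induction l generalizing w with
  | nil => trivial
  | cons x l ih =>
    refine ⟨hl.1.transport θ, ?_⟩
    rw [reflexion_transport]
    exact ih hl.2

theorem pathEnd_transport (w : SuperRootDatum X h) (θ : h ≃ₗ[ℂ] h) (l : List X) :
    (w.transport θ).pathEnd l = (w.pathEnd l).transport θ := by
  induction l generalizing w with
  | nil => rfl
  | cons x l ih =>
    change ((w.transport θ).reflexion x).pathEnd l = ((w.reflexion x).pathEnd l).transport θ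
    rw [reflexion_transport, ih]

theorem isPath_append {w : SuperRootDatum X h} {l l' : List X} :
    w.IsPath (l ++ l') ↔ w.IsPath l ∧ (w.pathEnd l).IsPath l' := by
  induction l generalizing w with
  | nil => simp [IsPath, pathEnd]
  | cons x l ih => simp [IsPath, pathEnd, ih, and_assoc]

theorem pathEnd_append (w : SuperRootDatum X h) (l l' : List X) :
    w.pathEnd (l ++ l') = (w.pathEnd l).pathEnd l' := by
  induction l generalizing w with
  | nil => rfl
  | cons x l ih => exact ih _

theorem pathArrow_val (w : SuperRootDatum X h) (l : List X) (hl : w.IsPath l) :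
    (w.pathArrow l hl).1 = LinearEquiv.refl ℂ h := by
  induction l generalizing w with
  | nil => rfl
  | cons x l ih =>
    change (LinearEquiv.refl ℂ h).trans (pathArrow (w.reflexion x) l hl.2).1 = _
    rw [ih]
    rfl

theorem sigma_arrow_ext {v w w' : SuperRootDatum X h} (hw : w = w') (f : Arrow v w)
    (f' : Arrow v w') (hf : f.1 = f'.1) :
    (⟨w, f⟩ : Σ w : SuperRootDatum X h, Arrow v w) = ⟨w', f'⟩ := by
  subst hw
  rw [Subtype.ext hf]

/-- The first step of a path at which a simple root changes sign. -/
theorem CommonRoots.exists_append_eq {C : Set (SuperRootDatum X h)} {Δ : Set (Module.Dual ℂ h)}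
    (hC : CommonRoots C Δ) {w : SuperRootDatum X h} {l : List X} {α : Module.Dual ℂ h}
    (hw : w ∈ C) (hl : w.IsPath l) (hα : α ∈ simpleRoots C) (hpos : w.Pos α)
    (hneg : ¬ (w.pathEnd l).Pos α) :
    ∃ l₁ x l₂, l = l₁ ++ x :: l₂ ∧ (w.pathEnd l₁).b x = α := by
  induction l generalizing w with
  | nil => exact absurd hpos hneg
  | cons x l ih =>
    by_cases hαx : α = w.b x
    · exact ⟨[], x, l, rfl, hαx.symm⟩
    · obtain ⟨l₁, y, l₂, h1, h2⟩ := ih (hC.reflexion_mem hw hl.1) hl.2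
        (hC.pos_reflexion hw hl.1 hα hαx hpos) hneg
      exact ⟨x :: l₁, y, l₂, by rw [h1]; rfl, h2⟩

end SuperRootDatum

/-- Equality in the sigma type expresses at once that the end vertices agree and that the
compositions coincide. -/
theorem mainTheorem4 {X : Type v} [Finite X] [DecidableEq X]
    {h : Type u} [AddCommGroup h] [Module ℂ h] [FiniteDimensional ℂ h]
    (v : SuperRootDatum X h) (hv : v.Admissible)
    (v₀ v₀' : SuperRootDatum X h) (hv₀ : v₀ ∈ v.skeleton)
    (xs : List X) (hshort : v₀.IsShortest xs)
    (y : X) (hrefl : v₀'.Reflectable y) (haniso : v₀'.Anisotropic y)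
    (hy : v₀'.reflexion y = v₀)
    (hnot : ¬ v₀'.IsShortest (y :: xs)) :
    ∃ j : ℕ, 1 ≤ j ∧ j ≤ xs.length ∧
      ∃ (hpath : v₀'.IsPath (y :: xs.take j)) (hname : v₀'.IsPath (xs.take (j - 1))),
        (⟨v₀'.pathEnd (y :: xs.take j), v₀'.pathArrow (y :: xs.take j) hpath⟩ :
            Σ w : SuperRootDatum X h, SuperRootDatum.Arrow v₀' w) =
          ⟨v₀'.pathEnd (xs.take (j - 1)), v₀'.pathArrow (xs.take (j - 1)) hname⟩ := by
  open SuperRootDatum in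
  obtain ⟨Δ, hC⟩ := hv.exists_commonRoots
  set C := v.idComponent
  have hv₀C : v₀ ∈ C := by
    obtain ⟨l, hl, rfl⟩ := hv₀
    exact (Walk.of_isPath v l hl).mem hC v.self_mem_idComponent
  have hv₀' : v₀' = v₀.reflexion y := by rw [← hy, reflexion_reflexion]
  have hyr : v₀.Reflectable y := by rw [← hy]; exact hrefl.reflexion
  have hya : v₀.Anisotropic y := by
    rw [← hy, Anisotropic, cartan_reflexion_self]; exact haniso
  have hwalk := Walk.of_isPath v₀ xs hshort.1
  have hlen : xs.length = separation C v₀ (v₀.pathEnd xs) := by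
    obtain ⟨l, h1, h2, h3⟩ := (hC.walk_separation hv₀C hwalk).exists_isPath
    have h4 := hshort.2 l h1 h2
    obtain ⟨k, hk⟩ := hC.exists_length_eq hv₀C hwalk
    omega
  -- Otherwise prepending `y` raises the separation by one, and the longer path attains it, hence is
  -- shortest.
  have hneg : ¬ (v₀.pathEnd xs).Pos (v₀.b y) := by
    intro hpos
    have h1 := hC.reflexion_separation hv₀C hwalk hyr hpos
    rw [← hv₀'] at h1
    refine hnot ⟨⟨hrefl, hy.symm ▸ hshort.1⟩, fun l hl hend => ?_⟩
    have h2 := Walk.of_isPath v₀' l hl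
    rw [hend, pathEnd, hy] at h2
    obtain ⟨k, hk⟩ := hC.exists_length_eq (hv₀' ▸ hC.reflexion_mem hv₀C hyr) h2
    rw [List.length_cons]
    omega
  obtain ⟨l₁, x, l₂, hxs, hb⟩ := hC.exists_append_eq hv₀C hshort.1 ⟨v₀, hv₀C, y, rfl⟩
    (v₀.pos_b y) hneg
  have hpath := hshort.1
  rw [hxs, List.append_cons, isPath_append] at hpath
  have hpath₁ := (isPath_append.1 hpath.1).1
  have htC : v₀.pathEnd l₁ ∈ C := (Walk.of_isPath v₀ l₁ hpath₁).mem hC hv₀C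
  obtain ⟨c, hc⟩ := hC.a_eq htC hv₀C hb
  have hta : (v₀.pathEnd l₁).Anisotropic x := by
    have hc0 : c ≠ 0 := by
      rintro rfl
      exact (v₀.pathEnd l₁).linInd_a.ne_zero x (by rw [hc, zero_smul])
    rw [Anisotropic, cartan, hb, hc, map_smul, smul_eq_mul]
    exact mul_ne_zero hc0 hya
  -- The reflexion at `x` from the vertex before the crossing and the one at `y` from `v₀` are the
  -- same linear map of `h`, although `x` and `y` may differ.
  have hs := linearReflection_congr hta hya hc hb
  have htrans : v₀' = v₀.transport (v₀.linearReflection y hya) := by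
    rw [hv₀', reflexion_eq_transport hya]
  have htake : xs.take (l₁.length + 1) = l₁ ++ [x] := by
    rw [hxs, List.append_cons, List.take_left' (by simp)]
  have htake' : xs.take (l₁.length + 1 - 1) = l₁ := by
    rw [hxs, Nat.add_sub_cancel, List.take_left' rfl]
  refine ⟨l₁.length + 1, by omega, by rw [hxs]; simp, ?_, ?_, ?_⟩
  · rw [htake]
    exact ⟨hrefl, hy.symm ▸ hpath.1⟩
  · rw [htake', htrans]
    exact hpath₁.transport _
  · refine sigma_arrow_ext ?_ _ _ ?_
    · rw [htake, htake']
      change (v₀'.reflexion y).pathEnd (l₁ ++ [x]) = _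
      rw [hy, pathEnd_append, htrans, pathEnd_transport, ← hs]
      exact reflexion_eq_transport hta
    · rw [pathArrow_val, pathArrow_val]
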